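/- **Setting.** Let $n\ge 2$, let $\Omega,Q\subset\mathbb R^n$ be bounded open sets (container and reference configuration of the solid), $M\subset\partial Q$, $P:=\partial Q\setminus M$, and let a boundary datum on $P$ be given. Let $q>n$ and let $k_0\in\mathbb N$ with $k_0>\frac n2+2$. Let $\tau,h,\kappa,\varepsilon,\delta,\mu,\lambda,\varrho_s>0$. Sobolev maps in $W^{2,q}(Q)$ and in $W^{k_0,2}$ are identified with their $C^1$ representatives, taken continuous up to the boundary, and boundary conditions are understood pointwise for these representatives. * *Elastic energy.* $E$ takes values in $[-\infty,\infty]$ and there is $E_{\min}\in\mathbb R$ with $E(\eta)\ge E_{\min}$ for $\eta\in W^{2,q}(Q;\mathbb R^n)$. Let $\mathcal E$ be the set of $\eta\in W^{2,q}(Q;\Omega)$ with $E(\eta)<\infty$, $|\eta(Q)|=\int_Q\det\nabla\eta\,dy$ and $\eta$ equal to the given datum on $P$. For $\eta\in\mathcal E$ put $\Omega_\eta:=\Omega\setminus\eta(\overline Q)$. * *Solid dissipation.* $R$ is real valued and $R(\eta,lb)=l^2R(\eta,b)$ for $\eta\in\mathcal E$, $b\in W^{1,2}(Q;\mathbb R^n)$,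 $l\in\mathbb R$. * $E_\kappa(\eta)=E(\eta)+\kappa\|\nabla^{k_0}\eta\|_{L^2(Q)}^2$ and $R_\kappa(\eta,b)=R(\eta,b)+\kappa\|\nabla^{k_0}b\|_{L^2(Q)}^2$. * *Pressure.* $p:[0,\infty)\to[0,\infty)$, $p\in C^2((0,\infty))\cap C^1([0,\infty))$, $p'>0$ on $(0,\infty)$, and $\lim_{s\to\infty}p'(s)/s^{\gamma-1}=a$ for some $a>0$ and $\gamma>\frac{2n(n-1)}{3n-2}$. With $\beta>\max\{4,\gamma\}$ put $p_\delta(s)=p(s)+\delta s^\beta+\delta s^2$ and $H_\delta(s)=s\int_c^s p_\delta(z)z^{-2}\,dz$ for a fixed $c\ge 0$; if $c=0$, it is assumed that $p_\delta(z)z^{-2}$ is integrable on $(0,1)$. Put $U^\delta_\eta(\varrho)=\int_{\Omega_\eta}H_\delta(\varrho)\,dx$. * *Viscous stress.* $\mathbb S(G)=2\mu\big(\tfrac12(G+G^\top)-\tfrac13\operatorname{tr}(G)\,\mathbb I\big)+\lambda\operatorname{tr}(G)\,\mathbb I$. **Data.** Let $\eta_0\in\mathcal E\cap W^{k_0,2}(Q;\mathbb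 R^n)$, $\Omega_0=\Omega_{\eta_0}$, $\varrho_0\in L^\beta(\Omega_0)$ with $\varrho_0>0$ a.e., $\zeta\in L^2([0,h]\times Q;\mathbb R^n)$, $w\in L^2([0,h]\times\Omega_0;\mathbb R^n)$, $f_s\in C([0,h];L^2(Q;\mathbb R^n))$, $f_f\in C([0,h];L^2(\Omega;\mathbb R^n))$. Let $N\in\mathbb N_0$ with $\tau N\le h$, and for $k<N$ let $\zeta_k$, $w_k$ be the averages of $\zeta$, $w$ over $[\tau k,\tau(k+1)]$. **Scheme.** For a velocity $v$ put $\Psi_v=\mathrm{id}+\tau v$. Let $\Phi_0=\mathrm{id}$ and, for $k=0,\dots,N-1$, given $\eta_k$, $\Omega_k:=\Omega_{\eta_k}$, $\varrho_k$ and $\Phi_k$, let $\tilde\varrho_k=(\mathrm{id}-\tau\varepsilon\Delta)^{-1}\varrho_k\in W^{1,2}(\Omega_k)$ be the weak solution of $\tilde\varrho_k-\tau\varepsilon\Delta\tilde\varrho_k=\varrho_k$ in $\Omega_k$, $\partial_\nu\tilde\varrho_k=0$ on $\partial\Omega_k$, that is $$\int_{\Omega_k}\tilde\varrho_k\psi\,dx+\tau\varepsilon\int_{\Omega_k}\nabla\tilde\varrho_k\cdot\nabla\psi\,dx=\int_{\Omega_k}\varrho_k\psi\,dx\qquad\text{for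 all }\psi\in W^{1,2}(\Omega_k).$$ Let $(\eta_{k+1},v_{k+1},\varrho_{k+1})$ be a minimiser of $$\begin{aligned}(\eta,v,\varrho)\mapsto\;&E_\kappa(\eta)+U^\delta_\eta(\varrho)+\tau\Big[R_\kappa\big(\eta_k,\tfrac{\eta-\eta_k}\tau\big)+\int_{\Omega_k}\tfrac12\mathbb S(\nabla v):\nabla v\,dx+\tfrac\kappa2\int_{\Omega_k}|\nabla^{k_0}v|^2dx\Big]\\&+\frac{\tau}{2h}\Big[\varrho_s\int_Q\big|\tfrac{\eta-\eta_k}\tau-\zeta_k\big|^2dy+\int_{\Omega_k}\big|\sqrt{\varrho_k}\,v-\sqrt{\det\nabla\Phi_k^{-1}}\,w_k\circ\Phi_k^{-1}\big|^2dx\Big]\\&-\tau\int_Q\tfrac{\eta-\eta_k}\tau\cdot f_s(\tau k)\,dy-\tau\int_{\Omega_k}\varrho_k v\cdot f_f(\tau k)\,dx\end{aligned}$$ among all $\eta\in\mathcal E\cap W^{k_0,2}(Q)$, $v\in W^{k_0,2}(\Omega_k;\mathbb R^n)$, $\varrho\in L^\beta(\Omega_\eta)$ such that $v=0$ on $\partial\Omega\cap\overline{\Omega_k}$,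 $\frac{\eta-\eta_k}\tau=v\circ\eta_k$ on $M$, $\Psi_v$ is a $C^1$ diffeomorphism of $\Omega_k$ onto $\Omega_\eta$ with $\det\nabla\Psi_v>0$, and $\varrho\circ\Psi_v=\tilde\varrho_k/\det\nabla\Psi_v$ a.e. in $\Omega_k$. Finally $\Phi_{k+1}=\Psi_{v_{k+1}}\circ\Phi_k$. **Claim (discrete energy inequality).** For $k<N$ the function $H_\delta''(\tilde\varrho_k)|\nabla\tilde\varrho_k|^2$ is integrable on $\Omega_k$, and $$\begin{aligned} &E_\kappa(\eta_N)+U^\delta_{\eta_N}(\varrho_N)+\sum_{k=0}^{N-1}\tau\frac\kappa2\int_{\Omega_k}|\nabla^{k_0}v_{k+1}|^2dx\\ &+\sum_{k=0}^{N-1}\tau\Big[R_\kappa\big(\eta_k,\tfrac{\eta_{k+1}-\eta_k}\tau\big)+\frac12\int_{\Omega_k}\mathbb S(\nabla v_{k+1}):\nabla v_{k+1}\,dx+\varepsilon\int_{\Omega_k}H_\delta''(\tilde\varrho_k)|\nabla\tilde\varrho_k|^2dx\Big]\\ &+\sum_{k=0}^{N-1}\frac\tau{2h}\Big[\varrho_s\int_Q\big|\tfrac{\eta_{k+1}-\eta_k}\tau-\zeta_k\big|^2dy+\int_{\Omega_k}\big|\sqrt{\varrho_k}\,v_{k+1}-\sqrt{\det\nabla\Phi_k^{-1}}\,w_k\circ\Phi_k^{-1}\big|^2dx\Big]\\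 \le\;&E_\kappa(\eta_0)+U^\delta_{\eta_0}(\varrho_0)+\sum_{k=0}^{N-1}\frac\tau{2h}\Big[\varrho_s\int_Q|\zeta_k|^2dy+\int_{\Omega_0}|w_k|^2dx\Big]\\ &+\sum_{k=0}^{N-1}\tau\Big[\int_Q\tfrac{\eta_{k+1}-\eta_k}\tau\cdot f_s(\tau k)\,dy+\int_{\Omega_k}\varrho_k v_{k+1}\cdot f_f(\tau k)\,dx\Big]. \end{aligned}$$ -/

import Mathlib

open MeasureTheory Set
open scoped ContDiff ENNReal

noncomputable section

namespace FSI

/-- Euclidean space `ℝⁿ`. -/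
abbrev Vec (n : ℕ) : Type := EuclideanSpace ℝ (Fin n)

/-! ### Weak derivatives and Sobolev spaces on an open set -/

section Sobolev

variable {n : ℕ} {F : Type*} [NormedAddCommGroup F] [NormedSpace ℝ F]

/-- The classical partial derivative of order `m` in the coordinate directions `s 0, …, s (m-1)`. -/
def classicalPartial {m : ℕ} (s : Fin m → Fin n) (φ : Vec n → ℝ) (x : Vec n) : ℝ :=
  iteratedFDeriv ℝ m φ x (fun i => EuclideanSpace.single (s i) (1 : ℝ))

/-- `g` is the weak partial derivative of `f` on `U` in the directions `s 0, …, s (m-1)`. -/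
def HasWeakPartial (U : Set (Vec n)) {m : ℕ} (s : Fin m → Fin n) (f g : Vec n → F) : Prop :=
  LocallyIntegrableOn f U ∧ LocallyIntegrableOn g U ∧
    ∀ φ : Vec n → ℝ, ContDiff ℝ ∞ φ → HasCompactSupport φ → tsupport φ ⊆ U →
      ∫ x in U, classicalPartial s φ x • f x = (-1 : ℝ) ^ m • ∫ x in U, φ x • g x

/-- The Sobolev space `W^{k,p}(U; F)`. -/
def MemSobolev (U : Set (Vec n)) (k : ℕ) (p : ℝ≥0∞) (f : Vec n → F) : Prop :=
  MemLp f p (volume.restrict U) ∧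
    ∀ m ≤ k, ∀ s : Fin m → Fin n,
      ∃ g : Vec n → F, MemLp g p (volume.restrict U) ∧ HasWeakPartial U s f g

open Classical in
/-- The weak partial derivative on `U` (unique up to a null set of `U`; `0` if there is none). -/
def weakPartial (U : Set (Vec n)) {m : ℕ} (s : Fin m → Fin n) (f : Vec n → F) : Vec n → F :=
  if h : ∃ g : Vec n → F, HasWeakPartial U s f g then h.choose else 0

/-- `|∇ᵏ f|²`, the squared Frobenius norm of the tensor of all weak derivatives of order `k`. -/
def weakGradSq (U : Set (Vec n)) (k : ℕ) (f : Vec n → F) (x : Vec n) : ℝ :=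
  ∑ s : Fin k → Fin n, ‖weakPartial U s f x‖ ^ 2

/-- `∇u · ∇ψ` for scalar functions. -/
def weakGradDot (U : Set (Vec n)) (u ψ : Vec n → ℝ) (x : Vec n) : ℝ :=
  ∑ i : Fin n, weakPartial U ![i] u x * weakPartial U ![i] ψ x

/-- `u = (id - aΔ)⁻¹ f` for the homogeneous Neumann problem
`u - aΔu = f` in `U`, `∂_ν u = 0` on `∂U`, in its usual weak form. -/
def IsNeumannResolvent (U : Set (Vec n)) (a : ℝ) (f u : Vec n → ℝ) : Prop :=
  MemSobolev U 1 2 u ∧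
    ∀ ψ : Vec n → ℝ, MemSobolev U 1 2 ψ →
      (∫ x in U, u x * ψ x) + a * (∫ x in U, weakGradDot U u ψ x) = ∫ x in U, f x * ψ x

end Sobolev

/-! ### The stress tensor and the pressure -/

section Fluid

variable {n : ℕ}

/-- The classical velocity gradient `(∇v)ᵢⱼ = ∂ⱼvᵢ`. -/
def velGrad (v : Vec n → Vec n) (x : Vec n) : Matrix (Fin n) (Fin n) ℝ :=
  Matrix.of fun i j => (fderiv ℝ v x (EuclideanSpace.single j (1 : ℝ))) i

/-- Newton's law `S(G) = 2μ((G + Gᵀ)/2 - (1/3) tr(G) I) + λ tr(G) I`. -/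
def stress (mu lam : ℝ) (G : Matrix (Fin n) (Fin n) ℝ) : Matrix (Fin n) (Fin n) ℝ :=
  (2 * mu) • ((1 / 2 : ℝ) • (G + G.transpose) - (1 / 3 * G.trace) • (1 : Matrix (Fin n) (Fin n) ℝ))
    + (lam * G.trace) • (1 : Matrix (Fin n) (Fin n) ℝ)

/-- `A : B`. -/
def frobDot (A B : Matrix (Fin n) (Fin n) ℝ) : ℝ := ∑ i, ∑ j, A i j * B i j

/-- Assumptions on the pressure law `p : [0,∞) → [0,∞)` with growth exponent `γ`. -/
structure IsPressureLaw (n : ℕ) (p : ℝ → ℝ) (γ : ℝ) : Prop where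
  nonneg : ∀ s, 0 ≤ s → 0 ≤ p s
  contDiff_two : ContDiffOn ℝ 2 p (Ioi 0)
  contDiff_one : ContDiffOn ℝ 1 p (Ici 0)
  deriv_pos : ∀ s, 0 < s → 0 < deriv p s
  exponent : 2 * (n : ℝ) * ((n : ℝ) - 1) / (3 * (n : ℝ) - 2) < γ
  growth : ∃ a : ℝ, 0 < a ∧
    Filter.Tendsto (fun s : ℝ => deriv p s / s ^ (γ - 1)) Filter.atTop (nhds a)

/-- The regularised pressure `p_δ(s) = p(s) + δ s^β + δ s²`. -/
def regPressure (p : ℝ → ℝ) (δ β : ℝ) (s : ℝ) : ℝ := p s + δ * s ^ β + δ * s ^ 2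

/-- The regularised potential `H_δ(s) = s ∫_c^s p_δ(z) / z² dz`. -/
def regPotential (p : ℝ → ℝ) (δ β c : ℝ) (s : ℝ) : ℝ :=
  s * ∫ z in c..s, regPressure p δ β z / z ^ 2

end Fluid

/-! ### The minimisation scheme -/

/-- The data of the time-delayed problem (data only; the assumptions are stated separately). -/
structure Data (n : ℕ) where
  /-- the container -/
  Ω : Set (Vec n)
  /-- the reference configuration of the solid -/
  Q : Set (Vec n)
  /-- the part of `∂Q` that is in contact with the fluid -/
  M : Set (Vec n)
  /-- the Dirichlet datum on `∂Q \ M` -/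
  bdry : Vec n → Vec n
  /-- the elastic energy -/
  E : (Vec n → Vec n) → EReal
  /-- the solid dissipation -/
  R : (Vec n → Vec n) → (Vec n → Vec n) → ℝ
  /-- the pressure law -/
  p : ℝ → ℝ
  /-- the integrability exponent of `W^{2,q}` -/
  q : ℝ
  /-- the order of the regularisation -/
  k₀ : ℕ
  κ : ℝ
  τ : ℝ
  h : ℝ
  ε : ℝ
  δ : ℝ
  β : ℝ
  /-- the lower limit in the definition of `H_δ` -/
  c : ℝ
  mu : ℝ
  lam : ℝ
  /-- the density of the solid -/
  ρs : ℝ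
  /-- the previous solid velocity, as a function of time and space -/
  ζ : ℝ → Vec n → Vec n
  /-- the previous fluid quantity, as a function of time and space -/
  w : ℝ → Vec n → Vec n
  /-- the force on the solid -/
  fs : ℝ → Lp (Vec n) 2 (volume.restrict Q)
  /-- the force on the fluid -/
  ff : ℝ → Lp (Vec n) 2 (volume.restrict Ω)

namespace Data

variable {n : ℕ} (D : Data n)

/-- The open fluid domain `Ω_η`, the complement in `Ω` of the deformed solid. -/
def fluid (η : Vec n → Vec n) : Set (Vec n) := D.Ω \ η '' closure D.Q

/-- The admissible deformations `η ∈ 𝓔`: maps in `W^{2,q}(Q; Ω)`, `q > n`, represented by their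
continuously differentiable representative (continuous up to the boundary), of finite energy,
with the Ciarlet–Nečas condition and the Dirichlet condition on `P = ∂Q \ M`. -/
structure MemE (η : Vec n → Vec n) : Prop where
  sobolev : MemSobolev D.Q 2 (ENNReal.ofReal D.q) η
  contDiffOn : ContDiffOn ℝ 1 η D.Q
  continuousOn : ContinuousOn η (closure D.Q)
  mapsTo : MapsTo η D.Q D.Ω
  energy_lt_top : D.E η < ⊤
  ciarletNecas : (volume (η '' D.Q)).toReal = ∫ y in D.Q, (fderiv ℝ η y).det
  dirichlet : ∀ y ∈ frontier D.Q \ D.M, η y = D.bdry y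

/-- `H_δ`. -/
def H : ℝ → ℝ := regPotential D.p D.δ D.β D.c

/-- `U^δ_η(ρ) = ∫_{Ω_η} H_δ(ρ) dx`. -/
def U (η : Vec n → Vec n) (ρ : Vec n → ℝ) : ℝ := ∫ x in D.fluid η, D.H (ρ x)

/-- `E_κ(η) = E(η) + κ ‖∇^{k₀} η‖²_{L²(Q)}` (for `η` of finite energy). -/
def Eκ (η : Vec n → Vec n) : ℝ := (D.E η).toReal + D.κ * ∫ y in D.Q, weakGradSq D.Q D.k₀ η y

/-- `R_κ(η, b) = R(η, b) + κ ‖∇^{k₀} b‖²_{L²(Q)}`. -/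
def Rκ (η b : Vec n → Vec n) : ℝ := D.R η b + D.κ * ∫ y in D.Q, weakGradSq D.Q D.k₀ b y

/-- The time average `ζ_k` of `ζ` over `[τk, τ(k+1)]`. -/
def ζavg (k : ℕ) (y : Vec n) : Vec n := ⨍ t in Ioc (D.τ * k) (D.τ * (k + 1)), D.ζ t y

/-- The time average `w_k` of `w` over `[τk, τ(k+1)]`. -/
def wavg (k : ℕ) (x : Vec n) : Vec n := ⨍ t in Ioc (D.τ * k) (D.τ * (k + 1)), D.w t x

/-- `Ψ_v = id + τ v`. -/
def Ψ (v : Vec n → Vec n) (x : Vec n) : Vec n := x + D.τ • v x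

/-- The flow maps `Φ_0 = id`, `Φ_{k+1} = Ψ_{v_{k+1}} ∘ Φ_k`. -/
def Φ (v : ℕ → Vec n → Vec n) : ℕ → Vec n → Vec n
  | 0 => id
  | k + 1 => D.Ψ (v (k + 1)) ∘ Φ v k

/-- The difference quotient `(η - η_k) / τ`. -/
def dq (ηk η : Vec n → Vec n) (y : Vec n) : Vec n := D.τ⁻¹ • (η y - ηk y)

/-- The weighted transported quantity `√(det ∇Φ_k⁻¹) w_k ∘ Φ_k⁻¹`, where `Φ_k` is a
diffeomorphism from `Ω₀` onto `Ω_k`. -/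
def transported (Ω₀ : Set (Vec n)) (Φk : Vec n → Vec n) (wk : Vec n → Vec n) (x : Vec n) : Vec n :=
  √((fderiv ℝ (Function.invFunOn Φk Ω₀) x).det) • wk (Function.invFunOn Φk Ω₀ x)

/-- The inertial term of the solid, `ρ_s ∫_Q |(η - η_k)/τ - ζ_k|²`. -/
def solidInertia (k : ℕ) (ηk η : Vec n → Vec n) : ℝ :=
  D.ρs * ∫ y in D.Q, ‖D.dq ηk η y - D.ζavg k y‖ ^ 2

/-- The inertial term of the fluid, `∫_{Ω_k} |√ρ_k v - √(det ∇Φ_k⁻¹) w_k ∘ Φ_k⁻¹|²`. -/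
def fluidInertia (k : ℕ) (Ω₀ : Set (Vec n)) (Φk ηk : Vec n → Vec n) (ρk : Vec n → ℝ)
    (v : Vec n → Vec n) : ℝ :=
  ∫ x in D.fluid ηk, ‖√(ρk x) • v x - transported Ω₀ Φk (D.wavg k) x‖ ^ 2

/-- The viscous dissipation `∫_{Ω_k} S(∇v) : ∇v`. -/
def viscous (ηk v : Vec n → Vec n) : ℝ :=
  ∫ x in D.fluid ηk, frobDot (stress D.mu D.lam (velGrad v x)) (velGrad v x)

/-- The power `∫_Q (η - η_k)/τ · f_s(τk) + ∫_{Ω_k} ρ_k v · f_f(τk)` of the forces. -/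
def forcePower (k : ℕ) (ηk : Vec n → Vec n) (ρk : Vec n → ℝ) (η v : Vec n → Vec n) : ℝ :=
  (∫ y in D.Q, inner ℝ (D.dq ηk η y) (D.fs (D.τ * k) y)) +
    ∫ x in D.fluid ηk, ρk x * inner ℝ (v x) (D.ff (D.τ * k) x)

/-- The functional that is minimised in the step from `k` to `k + 1`. -/
def functional (k : ℕ) (Ω₀ : Set (Vec n)) (Φk ηk : Vec n → Vec n) (ρk : Vec n → ℝ)
    (η v : Vec n → Vec n) (ρ : Vec n → ℝ) : ℝ :=
  D.Eκ η + D.U η ρ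
    + D.τ * (D.Rκ ηk (D.dq ηk η) + 1 / 2 * D.viscous ηk v
        + D.κ / 2 * (∫ x in D.fluid ηk, weakGradSq (D.fluid ηk) D.k₀ v x))
    + D.τ / (2 * D.h) * (D.solidInertia k ηk η + D.fluidInertia k Ω₀ Φk ηk ρk v)
    - D.τ * D.forcePower k ηk ρk η v

/-- The admissible triples `(η, v, ρ)` of one step, given `η_k` and
`ρ̃_k = (id - τεΔ)⁻¹ ρ_k`. The velocity `v ∈ W^{k₀,2}(Ω_k)` is represented by its continuously
differentiable representative, continuous up to the boundary. The last four conditions express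
`ρ ∘ Ψ_v = ρ̃_k / det ∇Ψ_v`: the density `ρ ∈ L^β(Ω_η)` is transported by the diffeomorphism
`Ψ_v : Ω_k → Ω_η`. -/
structure IsAdmissible (ηk : Vec n → Vec n) (ρtk : Vec n → ℝ)
    (η v : Vec n → Vec n) (ρ : Vec n → ℝ) : Prop where
  memE : D.MemE η
  sobolev : MemSobolev D.Q D.k₀ 2 η
  v_sobolev : MemSobolev (D.fluid ηk) D.k₀ 2 v
  v_contDiffOn : ContDiffOn ℝ 1 v (D.fluid ηk)
  v_continuousOn : ContinuousOn v (closure (D.fluid ηk))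
  v_zero : ∀ x ∈ frontier D.Ω ∩ closure (D.fluid ηk), v x = 0
  coupling : ∀ y ∈ D.M, D.dq ηk η y = v (ηk y)
  bijOn : BijOn (D.Ψ v) (D.fluid ηk) (D.fluid η)
  det_pos : ∀ x ∈ D.fluid ηk, 0 < (fderiv ℝ (D.Ψ v) x).det
  ρ_memLp : MemLp ρ (ENNReal.ofReal D.β) (volume.restrict (D.fluid η))
  transport : ∀ᵐ x ∂(volume.restrict (D.fluid ηk)),
    ρ (D.Ψ v x) = ρtk x / (fderiv ℝ (D.Ψ v) x).det

/-- `(η, v, ρ)` solves the minimisation problem of the step from `k` to `k + 1`. -/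
def IsMinimizer (k : ℕ) (Ω₀ : Set (Vec n)) (Φk ηk : Vec n → Vec n) (ρk ρtk : Vec n → ℝ)
    (η v : Vec n → Vec n) (ρ : Vec n → ℝ) : Prop :=
  D.IsAdmissible ηk ρtk η v ρ ∧
    ∀ (η' v' : Vec n → Vec n) (ρ' : Vec n → ℝ), D.IsAdmissible ηk ρtk η' v' ρ' →
      D.functional k Ω₀ Φk ηk ρk η v ρ ≤ D.functional k Ω₀ Φk ηk ρk η' v' ρ'

end Data

end FSI

end

namespace FSI

open Filter Topology Convolution ContinuousLinearMap

/-! ### Weak derivatives -/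

section WeakDerivatives

variable {n : ℕ} {F : Type*} [NormedAddCommGroup F] [NormedSpace ℝ F]

/-! Each step compares the minimiser with the competitor (η_k, 0, ρ̃_k): solid and fluid at rest,
density only regularised. It is admissible because Ψ_0 = id, provided ρ̃_k ∈ L^β. All its
dissipation and force terms vanish (R_κ by homogeneity), and its inertial terms are the squares of
the data, the fluid one becoming ∫_{Ω_0}|w_k|² after the change of variables by Φ_k
(`Data.functional_self`). Minimality thus bounds the functional at step k+1 by E_κ(η_k) + U(ρ̃_k)
plus data.

It remains to see that U(ρ̃_k) + τε ∫ H''(ρ̃_k)|∇ρ̃_k|² ≤ U(ρ_k)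
(`IsNeumannResolvent.potential_estimate`). Formally one tests the Neumann problem with H'(ρ̃_k) and
uses the tangent inequality H(ρ̃) + H'(ρ̃)(ρ − ρ̃) ≤ H(ρ). But H'' may be singular at 0 and grows at
infinity, so H'(ρ̃_k) need not be a test function. Three ingredients make this rigorous: the chain
rule for C¹ functions with bounded derivative (`MemSobolev.comp`), strict positivity of ρ̃_k
(`IsNeumannResolvent.ae_pos`), and approximation of H, normalised by its tangent at 1, from below by
convex functions with bounded first and second derivatives, followed by Fatou
(`exists_convex_truncation`, `IsNeumannResolvent.convex_estimate`). Applied to a power function, the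
same estimate gives ρ̃_k ∈ L^β.

Positivity and integrability of the density and the diffeomorphism property of Φ_k pass from step to
step (`Data.IsRegularState.step`). Summation over k telescopes the energies. -/

theorem HasWeakPartial.ae_eq [CompleteSpace F] {U : Set (Vec n)} (hU : IsOpen U) {m : ℕ}
    {s : Fin m → Fin n} {f g₁ g₂ : Vec n → F}
    (h₁ : HasWeakPartial U s f g₁) (h₂ : HasWeakPartial U s f g₂) :
    g₁ =ᵐ[volume.restrict U] g₂ := by
  have key : ∀ᵐ x ∂volume, x ∈ U → (g₁ - g₂) x = 0 := by
    refine hU.ae_eq_zero_of_integral_contDiff_smul_eq_zero (h₁.2.1.sub h₂.2.1) ?_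
    intro φ hφ hc hs
    have hint : ∀ g : Vec n → F, LocallyIntegrableOn g U volume →
        Integrable (fun x => φ x • g x) volume ∧
          ∫ x in U, φ x • g x = ∫ x, φ x • g x := by
      intro g hg
      constructor
      · have h1 : IntegrableOn g (tsupport φ) := hg.integrableOn_compact_subset hs hc
        have h2 : IntegrableOn (fun x => φ x • g x) (tsupport φ) :=
          h1.continuousOn_smul hφ.continuous.continuousOn hc
        refine (integrableOn_iff_integrable_of_support_subset ?_).1 h2
        exact fun x hx => subset_tsupport φ (fun h0 => hx (by simp [h0]))
      · refine setIntegral_eq_integral_of_forall_compl_eq_zero fun x hx => ?_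
        have : φ x = 0 := image_eq_zero_of_notMem_tsupport fun h => hx (hs h)
        simp [this]
    have e := (h₁.2.2 φ hφ hc hs).symm.trans (h₂.2.2 φ hφ hc hs)
    rw [(hint g₁ h₁.2.1).2, (hint g₂ h₂.2.1).2] at e
    have hne : ((-1 : ℝ) ^ m) ≠ 0 := pow_ne_zero _ (by norm_num)
    have e' := smul_right_injective F hne e
    simp only [Pi.sub_apply, smul_sub]
    rw [integral_sub (hint g₁ h₁.2.1).1 (hint g₂ h₂.2.1).1, e', sub_self]
  rw [EventuallyEq, ae_restrict_iff' hU.measurableSet]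
  filter_upwards [key] with x hx hxU
  simpa [sub_eq_zero] using hx hxU

theorem weakPartial_spec {U : Set (Vec n)} {m : ℕ} {s : Fin m → Fin n} {f g : Vec n → F}
    (h : HasWeakPartial U s f g) : HasWeakPartial U s f (weakPartial U s f) := by
  have hex : ∃ g : Vec n → F, HasWeakPartial U s f g := ⟨g, h⟩
  rw [weakPartial, dif_pos hex]
  exact hex.choose_spec

/-- Lets the arbitrary choice inside `weakPartial` be replaced by any explicitly computed weak
derivative under an integral. -/
theorem HasWeakPartial.weakPartial_ae_eq [CompleteSpace F] {U : Set (Vec n)} (hU : IsOpen U)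
    {m : ℕ} {s : Fin m → Fin n} {f g : Vec n → F} (h : HasWeakPartial U s f g) :
    weakPartial U s f =ᵐ[volume.restrict U] g :=
  (weakPartial_spec h).ae_eq hU h

theorem hasWeakPartial_zero (U : Set (Vec n)) {m : ℕ} (s : Fin m → Fin n) :
    HasWeakPartial U s (0 : Vec n → F) 0 := by
  refine ⟨locallyIntegrableOn_zero, locallyIntegrableOn_zero, fun φ _ _ _ => by simp⟩

theorem memSobolev_zero (U : Set (Vec n)) (k : ℕ) (p : ℝ≥0∞) :
    MemSobolev U k p (0 : Vec n → F) :=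
  ⟨MemLp.zero, fun _ _ s => ⟨0, MemLp.zero, hasWeakPartial_zero U s⟩⟩

theorem integral_weakGradSq_zero [CompleteSpace F] {U : Set (Vec n)} (hU : IsOpen U) (k : ℕ) :
    ∫ x in U, weakGradSq U k (0 : Vec n → F) x = 0 := by
  have h : ∀ᵐ x ∂volume.restrict U, ∀ s : Fin k → Fin n,
      weakPartial U s (0 : Vec n → F) x = 0 := by
    rw [ae_all_iff]
    intro s
    filter_upwards [(hasWeakPartial_zero (F := F) U s).weakPartial_ae_eq hU] with x hx
    simpa using hx
  rw [integral_congr_ae (g := fun _ => (0 : ℝ)), integral_zero]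
  filter_upwards [h] with x hx
  simp [weakGradSq, hx]

theorem MemSobolev.hasWeakPartial {U : Set (Vec n)} {k : ℕ} {p : ℝ≥0∞} {f : Vec n → F}
    (hf : MemSobolev U k p f) {m : ℕ} (hm : m ≤ k) (s : Fin m → Fin n) :
    HasWeakPartial U s f (weakPartial U s f) := by
  obtain ⟨g, -, hg⟩ := hf.2 m hm s
  exact weakPartial_spec hg

theorem MemSobolev.memLp_weakPartial [CompleteSpace F] {U : Set (Vec n)} (hU : IsOpen U) {k : ℕ}
    {p : ℝ≥0∞} {f : Vec n → F} (hf : MemSobolev U k p f) {m : ℕ} (hm : m ≤ k)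
    (s : Fin m → Fin n) : MemLp (weakPartial U s f) p (volume.restrict U) := by
  obtain ⟨g, hg, hg'⟩ := hf.2 m hm s
  exact (memLp_congr_ae (hg'.weakPartial_ae_eq hU)).2 hg

theorem classicalPartial_one (i : Fin n) (φ : Vec n → ℝ) (x : Vec n) :
    classicalPartial ![i] φ x = fderiv ℝ φ x (EuclideanSpace.single i (1 : ℝ)) := by
  simp [classicalPartial, iteratedFDeriv_one_apply]

end WeakDerivatives

/-! ### Mollification in `L¹` -/

section Mollification

/-- Scheffé's argument: |F − f| = (F − f) + 2(f − F)⁺, where the first term has integral zero and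
the second is dominated by f. -/
theorem tendsto_integral_abs_sub_of_nonneg {α : Type*} [MeasurableSpace α] {μ : Measure α}
    {f : α → ℝ} {F : ℕ → α → ℝ} (hf : Integrable f μ) (hF : ∀ m, Integrable (F m) μ)
    (hF0 : ∀ m, 0 ≤ᵐ[μ] F m) (hf0 : 0 ≤ᵐ[μ] f)
    (hint : ∀ m, ∫ x, F m x ∂μ = ∫ x, f x ∂μ)
    (hlim : ∀ᵐ x ∂μ, Tendsto (fun m => F m x) atTop (𝓝 (f x))) :
    Tendsto (fun m => ∫ x, |F m x - f x| ∂μ) atTop (𝓝 0) := by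
  have h1 : ∀ m, ∫ x, |F m x - f x| ∂μ = 2 * ∫ x, max (f x - F m x) 0 ∂μ := by
    intro m
    have e : ∀ x, |F m x - f x| = (F m x - f x) + 2 * max (f x - F m x) 0 := by
      intro x
      rcases le_total (F m x) (f x) with h | h
      · rw [abs_of_nonpos (by linarith), max_eq_left (by linarith)]; ring
      · rw [abs_of_nonneg (by linarith), max_eq_right (by linarith)]; ring
    have hm : Integrable (fun x => max (f x - F m x) 0) μ := (hf.sub (hF m)).pos_part
    simp_rw [e]
    have hs : Integrable (fun x => F m x - f x) μ := (hF m).sub hf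
    rw [integral_add hs (hm.const_mul 2), integral_sub (hF m) hf, hint m,
      integral_const_mul]
    ring
  simp_rw [h1]
  have h2 : Tendsto (fun m => ∫ x, max (f x - F m x) 0 ∂μ) atTop (𝓝 (∫ _, (0 : ℝ) ∂μ)) := by
    refine tendsto_integral_of_dominated_convergence (fun x => |f x|)
      (fun m => ((hf.sub (hF m)).pos_part).aestronglyMeasurable) hf.abs ?_ ?_
    · intro m
      filter_upwards [hF0 m, hf0] with x hx hx'
      simp only [Pi.zero_apply] at hx hx'
      rw [Real.norm_eq_abs, abs_of_nonneg (le_max_right _ _), abs_of_nonneg hx']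
      exact max_le (by linarith) hx'
    · filter_upwards [hlim] with x hx
      have : Tendsto (fun m => max (f x - F m x) 0) atTop (𝓝 (max (f x - f x) 0)) :=
        (tendsto_const_nhds.sub hx).max tendsto_const_nhds
      simpa using this
  simpa using h2.const_mul 2

variable {n : ℕ}

/-- Mollification preserves sign and total mass and converges almost everywhere, so Scheffé's
argument applies to the positive and the negative part separately. The ratio bound `hK` on the radii
serves the almost everywhere convergence. -/
theorem tendsto_integral_abs_convolution_sub {f : Vec n → ℝ} (hf : Integrable f)
    {ξ : ℕ → ContDiffBump (0 : Vec n)} {K : ℝ}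
    (hξ : Tendsto (fun m => (ξ m).rOut) atTop (𝓝 0))
    (hK : ∀ m, (ξ m).rOut ≤ K * (ξ m).rIn) :
    Tendsto (fun m => ∫ x, |((ξ m).normed volume ⋆[lsmul ℝ ℝ, volume] f) x - f x|)
      atTop (𝓝 0) := by
  have hξi : ∀ m, Integrable ((ξ m).normed (volume : Measure (Vec n))) := fun m =>
    (ξ m).integrable_normed
  have hpos : ∀ g : Vec n → ℝ, Integrable g → (∀ x, 0 ≤ g x) →
      Tendsto (fun m => ∫ x, |((ξ m).normed volume ⋆[lsmul ℝ ℝ, volume] g) x - g x|)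
        atTop (𝓝 0) := by
    intro g hg hg0
    refine tendsto_integral_abs_sub_of_nonneg hg
      (fun m => (hξi m).integrable_convolution (lsmul ℝ ℝ) hg) ?_ (ae_of_all _ hg0) ?_ ?_
    · intro m
      refine ae_of_all _ fun x => integral_nonneg fun t => ?_
      simpa using mul_nonneg ((ξ m).nonneg_normed t) (hg0 _)
    · intro m
      rw [integral_convolution (lsmul ℝ ℝ) (hξi m) hg, (ξ m).integral_normed]
      simp
    · exact ContDiffBump.ae_convolution_tendsto_right_of_locallyIntegrable hξ
        (Eventually.of_forall hK) hg.locallyIntegrable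
  have hp := hpos (fun x => max (f x) 0) hf.pos_part fun x => le_max_right _ _
  have hq := hpos (fun x => max (-f x) 0) hf.neg_part fun x => le_max_right _ _
  have hpq := hp.add hq
  rw [add_zero] at hpq
  refine squeeze_zero (fun m => integral_nonneg fun x => abs_nonneg _) (fun m => ?_) hpq
  have i1 : Integrable ((ξ m).normed volume ⋆[lsmul ℝ ℝ, volume] fun x => max (f x) 0) :=
    (hξi m).integrable_convolution (lsmul ℝ ℝ) hf.pos_part
  have i2 : Integrable ((ξ m).normed volume ⋆[lsmul ℝ ℝ, volume] fun x => max (-f x) 0) :=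
    (hξi m).integrable_convolution (lsmul ℝ ℝ) hf.neg_part
  have i0 : Integrable ((ξ m).normed volume ⋆[lsmul ℝ ℝ, volume] f) :=
    (hξi m).integrable_convolution (lsmul ℝ ℝ) hf
  have j1 : Integrable (fun x =>
      |((ξ m).normed volume ⋆[lsmul ℝ ℝ, volume] fun x => max (f x) 0) x - max (f x) 0|) :=
    (i1.sub hf.pos_part).abs
  have j2 : Integrable (fun x =>
      |((ξ m).normed volume ⋆[lsmul ℝ ℝ, volume] fun x => max (-f x) 0) x - max (-f x) 0|) :=
    (i2.sub hf.neg_part).abs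
  rw [← integral_add j1 j2]
  have c1 := (hξi m).ae_convolution_exists (lsmul ℝ ℝ) hf.pos_part
  have c2 := (hξi m).ae_convolution_exists (lsmul ℝ ℝ) hf.neg_part
  refine integral_mono_ae (i0.sub hf).abs (j1.add j2) ?_
  filter_upwards [c1, c2] with x h1 h2
  have hsplit : ∀ y, f y = max (f y) 0 - max (-f y) 0 := fun y =>
    (max_zero_sub_max_neg_zero_eq_self (f y)).symm
  have e : ((ξ m).normed volume ⋆[lsmul ℝ ℝ, volume] f) x =
      ((ξ m).normed volume ⋆[lsmul ℝ ℝ, volume] fun x => max (f x) 0) x -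
        ((ξ m).normed volume ⋆[lsmul ℝ ℝ, volume] fun x => max (-f x) 0) x := by
    simp only [convolution_def]
    rw [← integral_sub h1 h2]
    refine integral_congr_ae (ae_of_all _ fun t => ?_)
    simp only [lsmul_apply, smul_eq_mul]
    rw [← mul_sub, ← hsplit]
  show |((ξ m).normed volume ⋆[lsmul ℝ ℝ, volume] f) x - f x| ≤ _ + _
  rw [e]
  have := abs_sub
    (((ξ m).normed volume ⋆[lsmul ℝ ℝ, volume] fun x => max (f x) 0) x - max (f x) 0)
    (((ξ m).normed volume ⋆[lsmul ℝ ℝ, volume] fun x => max (-f x) 0) x - max (-f x) 0)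
  refine le_trans (le_of_eq ?_) this
  congr 1
  have := hsplit x
  linarith

/-- Split B F = B (F − f) + B f: uniform boundedness of B controls the first term, dominated
convergence the second. -/
theorem tendsto_integral_mul_of_tendsto_L1 {α : Type*} [MeasurableSpace α] {μ : Measure α}
    {f b : α → ℝ} {F B : ℕ → α → ℝ} {C : ℝ} (hf : Integrable f μ) (hF : ∀ m, Integrable (F m) μ)
    (hB : ∀ m, AEStronglyMeasurable (B m) μ) (hBC : ∀ m x, |B m x| ≤ C)
    (hBb : ∀ᵐ x ∂μ, Tendsto (fun m => B m x) atTop (𝓝 (b x)))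
    (hFf : Tendsto (fun m => ∫ x, |F m x - f x| ∂μ) atTop (𝓝 0)) :
    Tendsto (fun m => ∫ x, B m x * F m x ∂μ) atTop (𝓝 (∫ x, b x * f x ∂μ)) := by
  have i1 : ∀ m, Integrable (fun x => B m x * (F m x - f x)) μ := fun m =>
    ((hF m).sub hf).bdd_mul (hB m) (ae_of_all _ fun x => by simpa using hBC m x)
  have i2 : ∀ m, Integrable (fun x => B m x * f x) μ := fun m =>
    hf.bdd_mul (hB m) (ae_of_all _ fun x => by simpa using hBC m x)
  have h1 : Tendsto (fun m => ∫ x, B m x * (F m x - f x) ∂μ) atTop (𝓝 0) := by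
    refine squeeze_zero_norm (fun m => ?_) (by simpa using hFf.const_mul C)
    rw [← integral_const_mul]
    refine (norm_integral_le_integral_norm _).trans
      (integral_mono (i1 m).norm (((hF m).sub hf).abs.const_mul C) fun x => ?_)
    simp only [norm_mul, Real.norm_eq_abs]
    exact mul_le_mul_of_nonneg_right (hBC m x) (abs_nonneg _)
  have h2 : Tendsto (fun m => ∫ x, B m x * f x ∂μ) atTop (𝓝 (∫ x, b x * f x ∂μ)) := by
    refine tendsto_integral_of_dominated_convergence (fun x => C * |f x|)
      (fun m => (i2 m).aestronglyMeasurable) (hf.abs.const_mul C) ?_ ?_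
    · intro m
      refine ae_of_all _ fun x => ?_
      rw [norm_mul]
      exact mul_le_mul_of_nonneg_right (hBC m x) (abs_nonneg _)
    · filter_upwards [hBb] with x hx using hx.mul_const _
  have h3 := h1.add h2
  rw [zero_add] at h3
  refine h3.congr fun m => ?_
  rw [← integral_add (i1 m) (i2 m)]
  exact integral_congr_ae (ae_of_all _ fun x => by ring)

end Mollification
end FSI

namespace FSI
open Filter Topology Convolution ContinuousLinearMap

/-! ### The chain rule for weak derivatives -/

section ChainRule

variable {n : ℕ}

theorem fderiv_convolution_apply {ξ f : Vec n → ℝ} (hξc : HasCompactSupport ξ)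
    (hξ : ContDiff ℝ 1 ξ) (hf : LocallyIntegrable f) (x e : Vec n) :
    fderiv ℝ (ξ ⋆[lsmul ℝ ℝ, volume] f) x e = ∫ y, fderiv ℝ ξ (x - y) e * f y := by
  rw [(hξc.hasFDerivAt_convolution_left (lsmul ℝ ℝ) hξ hf x).fderiv]
  have hex : ConvolutionExistsAt (fderiv ℝ ξ) f x ((lsmul ℝ ℝ).precompL (Vec n)) volume :=
    (hξc.fderiv ℝ).convolutionExists_left _ (hξ.continuous_fderiv (by norm_num)) hf x
  rw [convolution_def, ContinuousLinearMap.integral_apply hex]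
  rw [← integral_sub_left_eq_self _ volume x]
  simp [precompL_apply]

/-- The reflected kernel y ↦ ξ(x − y) is itself an admissible test function when its support lies in
K. Cutting off to K makes u globally integrable without changing the values that the kernel sees. -/
theorem fderiv_convolution_of_hasWeakPartial {U K : Set (Vec n)} {u w ξ : Vec n → ℝ} {i : Fin n}
    (hK : IsCompact K) (hKU : K ⊆ U) (hw : HasWeakPartial U ![i] u w)
    (hξc : HasCompactSupport ξ) (hξ : ContDiff ℝ ∞ ξ) {x : Vec n}
    (hx : ∀ t ∈ tsupport ξ, x - t ∈ K) :
    fderiv ℝ (ξ ⋆[lsmul ℝ ℝ, volume] K.indicator u) x (EuclideanSpace.single i (1 : ℝ)) =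
      (ξ ⋆[lsmul ℝ ℝ, volume] K.indicator w) x := by
  have hui : Integrable (K.indicator u) :=
    (hw.1.integrableOn_compact_subset hKU hK).integrable_indicator hK.measurableSet
  rw [fderiv_convolution_apply hξc (hξ.of_le (by norm_num)) hui.locallyIntegrable]
  set e := EuclideanSpace.single i (1 : ℝ)
  set φ : Vec n → ℝ := fun y => ξ (x - y) with hφ
  have hφs : ContDiff ℝ ∞ φ := hξ.comp (contDiff_const.sub contDiff_id)
  have hφe : φ = ξ ∘ (Homeomorph.subLeft x) := rfl
  have hts : tsupport φ = (Homeomorph.subLeft x) ⁻¹' tsupport ξ := by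
    rw [hφe, tsupport_comp_eq_preimage]
  have hφc : HasCompactSupport φ := by
    rw [hφe]; exact hξc.comp_homeomorph _
  have hφK : tsupport φ ⊆ K := by
    intro y hy
    rw [hts] at hy
    have := hx _ hy
    simpa using this
  have hd : ∀ y, fderiv ℝ φ y e = - fderiv ℝ ξ (x - y) e := by
    intro y
    have h1 : HasFDerivAt (fun y : Vec n => x - y) (-ContinuousLinearMap.id ℝ (Vec n)) y := by
      simpa using (hasFDerivAt_id y).const_sub x
    have h2 := ((hξ.differentiable (by norm_num)) (x - y)).hasFDerivAt.comp y h1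
    rw [show φ = ξ ∘ fun y => x - y from rfl, h2.fderiv]
    simp
  have hz : ∀ y, y ∉ K → φ y = 0 := fun y hy =>
    image_eq_zero_of_notMem_tsupport fun h => hy (hφK h)
  have hdz : ∀ y, y ∉ K → fderiv ℝ φ y e = 0 := fun y hy => by
    rw [fderiv_of_notMem_tsupport ℝ fun h => hy (hφK h)]; simp
  have key := hw.2.2 φ hφs hφc (hφK.trans hKU)
  rw [setIntegral_eq_integral_of_forall_compl_eq_zero
      (fun y hy => by
        rw [classicalPartial_one, hdz y fun h => hy (hKU h), zero_smul]),
    setIntegral_eq_integral_of_forall_compl_eq_zero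
      (fun y hy => by rw [hz y fun h => hy (hKU h), zero_smul])] at key
  rw [convolution_def, ← integral_sub_left_eq_self
    (fun t => (lsmul ℝ ℝ) (ξ t) (K.indicator w (x - t))) volume x]
  have e1 : ∫ y, fderiv ℝ ξ (x - y) e * K.indicator u y =
      - ∫ y, classicalPartial ![i] φ y • u y := by
    rw [← integral_neg]
    refine integral_congr_ae (ae_of_all _ fun y => ?_)
    simp only [classicalPartial_one, smul_eq_mul]
    by_cases hy : y ∈ K
    · rw [indicator_of_mem hy, hd]; ring
    · rw [indicator_of_notMem hy, hdz y hy]; ring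
  rw [e1, key]
  simp only [pow_one, neg_smul, one_smul, neg_neg]
  refine integral_congr_ae (ae_of_all _ fun y => ?_)
  simp only [sub_sub_cancel, lsmul_apply, smul_eq_mul]
  by_cases hy : y ∈ K
  · rw [indicator_of_mem hy]
  · rw [indicator_of_notMem hy, hz y hy]; simp

theorem lipschitz_of_deriv_le {g : ℝ → ℝ} {C : ℝ} (hg : ContDiff ℝ 1 g)
    (hC : ∀ s, |deriv g s| ≤ C) (s t : ℝ) : |g s - g t| ≤ C * |s - t| := by
  have := Convex.norm_image_sub_le_of_norm_deriv_le (f := g) (s := univ) (x := t) (y := s)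
    (fun x _ => (hg.differentiable (by norm_num)) x) (fun x _ => hC x) convex_univ trivial trivial
  simpa using this

/-- For mollified u this is classical integration by parts. The mollified gradient converges only in
L¹, which suffices since g' is bounded and continuous. -/
theorem integral_comp_of_hasWeakPartial {U : Set (Vec n)} (hU : IsOpen U) {u w : Vec n → ℝ}
    {i : Fin n} (hw : HasWeakPartial U ![i] u w) {g : ℝ → ℝ} {C : ℝ} (hg : ContDiff ℝ 1 g)
    (hC : ∀ s, |deriv g s| ≤ C) {φ : Vec n → ℝ} (hφ : ContDiff ℝ ∞ φ)
    (hφc : HasCompactSupport φ) (hφU : tsupport φ ⊆ U) :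
    ∫ x in U, fderiv ℝ φ x (EuclideanSpace.single i (1 : ℝ)) * g (u x) =
      - ∫ x in U, φ x * (deriv g (u x) * w x) := by
  set e : Vec n := EuclideanSpace.single i (1 : ℝ)
  -- The margin d leaves room for kernels of radius at most d: at points of the support of φ, the
  -- convolution only sees values in K ⊆ U.
  obtain ⟨d, hd, hdU⟩ := hφc.isCompact.exists_cthickening_subset_open hU hφU
  set K := Metric.cthickening d (tsupport φ) with hKdef
  have hK : IsCompact K := hφc.isCompact.cthickening
  have hφK : tsupport φ ⊆ K := Metric.self_subset_cthickening _
  set u' := K.indicator u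
  set w' := K.indicator w
  have hu' : Integrable u' :=
    (hw.1.integrableOn_compact_subset hdU hK).integrable_indicator hK.measurableSet
  have hw' : Integrable w' :=
    (hw.2.1.integrableOn_compact_subset hdU hK).integrable_indicator hK.measurableSet
  have hz : ∀ y, y ∉ tsupport φ → φ y = 0 := fun y hy => image_eq_zero_of_notMem_tsupport hy
  have hdz : ∀ y, y ∉ tsupport φ → fderiv ℝ φ y e = 0 := fun y hy => by
    rw [fderiv_of_notMem_tsupport ℝ hy]; simp
  have eL : ∫ x in U, fderiv ℝ φ x e * g (u x) = ∫ x, fderiv ℝ φ x e * g (u' x) := by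
    rw [setIntegral_eq_integral_of_forall_compl_eq_zero
      (fun y hy => by rw [hdz y fun h => hy (hφU h), zero_mul])]
    refine integral_congr_ae (ae_of_all _ fun y => ?_)
    by_cases hy : y ∈ tsupport φ
    · simp only [u', indicator_of_mem (hφK hy)]
    · simp [hdz y hy]
  have eR : ∫ x in U, φ x * (deriv g (u x) * w x) = ∫ x, (φ x * deriv g (u' x)) * w' x := by
    rw [setIntegral_eq_integral_of_forall_compl_eq_zero
      (fun y hy => by rw [hz y fun h => hy (hφU h), zero_mul])]
    refine integral_congr_ae (ae_of_all _ fun y => ?_)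
    by_cases hy : y ∈ tsupport φ
    · simp only [u', w', indicator_of_mem (hφK hy), mul_assoc]
    · simp [hz y hy]
  rw [eL, eR]
  -- the mollifiers
  have hr : ∀ m : ℕ, 0 < d / (2 * ((m : ℝ) + 1)) := fun m => by positivity
  let ξ : ℕ → ContDiffBump (0 : Vec n) := fun m =>
    ⟨d / (2 * ((m : ℝ) + 1)), 2 * (d / (2 * ((m : ℝ) + 1))), hr m, by linarith [hr m]⟩
  have hξr : ∀ m, (ξ m).rOut = d * (1 / ((m : ℝ) + 1)) := fun m => by
    show 2 * (d / (2 * ((m : ℝ) + 1))) = _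
    field_simp
  have hξ0 : Tendsto (fun m => (ξ m).rOut) atTop (𝓝 0) := by
    simp_rw [hξr]
    simpa using tendsto_one_div_add_atTop_nhds_zero_nat.const_mul d
  have hξd : ∀ m, (ξ m).rOut ≤ d := fun m => by
    rw [hξr]
    have : 1 / ((m : ℝ) + 1) ≤ 1 := by
      rw [div_le_one (by positivity)]; linarith [(Nat.cast_nonneg m : (0 : ℝ) ≤ m)]
    nlinarith
  have hξK : ∀ m, (ξ m).rOut ≤ 2 * (ξ m).rIn := fun m => le_rfl
  set U' : ℕ → Vec n → ℝ := fun m => (ξ m).normed volume ⋆[lsmul ℝ ℝ, volume] u'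
  set W' : ℕ → Vec n → ℝ := fun m => (ξ m).normed volume ⋆[lsmul ℝ ℝ, volume] w'
  have hUs : ∀ m, ContDiff ℝ 1 (U' m) := fun m =>
    (ξ m).hasCompactSupport_normed.contDiff_convolution_left _ (ξ m).contDiff_normed
      hu'.locallyIntegrable
  have hUi : ∀ m, Integrable (U' m) := fun m =>
    ((ξ m).integrable_normed).integrable_convolution (lsmul ℝ ℝ) hu'
  have hWi : ∀ m, Integrable (W' m) := fun m =>
    ((ξ m).integrable_normed).integrable_convolution (lsmul ℝ ℝ) hw'
  have hUd : ∀ m, ∀ x ∈ tsupport φ, fderiv ℝ (U' m) x e = W' m x := fun m x hx => by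
    refine fderiv_convolution_of_hasWeakPartial hK hdU hw (ξ m).hasCompactSupport_normed
      (ξ m).contDiff_normed fun t ht => ?_
    rw [(ξ m).tsupport_normed_eq] at ht
    refine Metric.mem_cthickening_of_dist_le _ x d _ hx ?_
    rw [mem_closedBall_zero_iff] at ht
    simpa [dist_eq_norm] using ht.trans (hξd m)
  have hgU : ∀ m, ContDiff ℝ 1 (fun x => g (U' m x)) := fun m => hg.comp (hUs m)
  have hφ1 : ContDiff ℝ 1 φ := hφ.of_le (by norm_num)
  have hφd : Continuous fun x => fderiv ℝ φ x e :=
    (hφ1.continuous_fderiv (by norm_num)).clm_apply continuous_const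
  have hφdc : HasCompactSupport fun x => fderiv ℝ φ x e :=
    hφc.mono' fun x hx => by
      by_contra h
      exact hx (hdz x h)
  have parts : ∀ m, ∫ x, fderiv ℝ φ x e * g (U' m x) =
      - ∫ x, (φ x * deriv g (U' m x)) * W' m x := fun m => by
    have hc1 : Continuous fun x => fderiv ℝ (fun x => g (U' m x)) x e :=
      ((hgU m).continuous_fderiv (by norm_num)).clm_apply continuous_const
    have := integral_mul_fderiv_eq_neg_fderiv_mul_of_integrable (μ := (volume : Measure (Vec n)))
      (f := φ) (g := fun x => g (U' m x)) (v := e)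
      ((hφd.mul (hgU m).continuous).integrable_of_hasCompactSupport hφdc.mul_right)
      ((hφ1.continuous.mul hc1).integrable_of_hasCompactSupport hφc.mul_right)
      ((hφ1.continuous.mul (hgU m).continuous).integrable_of_hasCompactSupport hφc.mul_right)
      (fun x _ => (hφ1.differentiable (by norm_num)) x)
      (fun x _ => ((hgU m).differentiable (by norm_num)) x)
    rw [eq_neg_iff_add_eq_zero, add_comm, ← eq_neg_iff_add_eq_zero, ← this]
    refine integral_congr_ae (ae_of_all _ fun x => ?_)
    by_cases hx : x ∈ tsupport φ
    · have h2 : HasFDerivAt (fun x => g (U' m x)) (deriv g (U' m x) • fderiv ℝ (U' m) x) x :=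
        ((hg.differentiable (by norm_num)) _).hasDerivAt.comp_hasFDerivAt x
          (((hUs m).differentiable (by norm_num)) x).hasFDerivAt
      simp only [h2.fderiv, smul_apply, smul_eq_mul, hUd m x hx, mul_assoc]
    · simp [hz x hx]
  have hL1 := tendsto_integral_abs_convolution_sub hu' hξ0 hξK
  have hW1 := tendsto_integral_abs_convolution_sub hw' hξ0 hξK
  have hae : ∀ᵐ x, Tendsto (fun m => U' m x) atTop (𝓝 (u' x)) :=
    ContDiffBump.ae_convolution_tendsto_right_of_locallyIntegrable hξ0
      (Eventually.of_forall hξK) hu'.locallyIntegrable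
  obtain ⟨Cφ, hCφ⟩ := hφc.exists_bound_of_continuous hφ1.continuous
  obtain ⟨Cd, hCd⟩ := hφdc.exists_bound_of_continuous hφd
  have hg' : Continuous (deriv g) := hg.continuous_deriv (by norm_num)
  have limR : Tendsto (fun m => ∫ x, (φ x * deriv g (U' m x)) * W' m x) atTop
      (𝓝 (∫ x, (φ x * deriv g (u' x)) * w' x)) := by
    refine tendsto_integral_mul_of_tendsto_L1 (C := Cφ * C) hw' hWi
      (fun m => (hφ1.continuous.mul (hg'.comp (hUs m).continuous)).aestronglyMeasurable)
      (fun m x => ?_) ?_ hW1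
    · rw [abs_mul]
      exact mul_le_mul (hCφ x) (hC _) (abs_nonneg _) ((norm_nonneg _).trans (hCφ x))
    · filter_upwards [hae] with x hx
      exact ((hg'.tendsto _).comp hx).const_mul _
  have limL : Tendsto (fun m => ∫ x, fderiv ℝ φ x e * g (U' m x)) atTop
      (𝓝 (∫ x, fderiv ℝ φ x e * g (u' x))) := by
    -- Only the difference is estimated globally, by the Lipschitz bound: g ∘ u' need not be
    -- integrable, since it equals g 0 off K.
    have hdiff : ∀ m, Integrable fun x => g (U' m x) - g (u' x) := fun m => by
      refine Integrable.mono' (g := fun x => C * |U' m x - u' x|)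
        (((hUi m).sub hu').abs.const_mul C) ?_
        (ae_of_all _ fun x => lipschitz_of_deriv_le hg hC _ _)
      exact ((hgU m).continuous.aestronglyMeasurable).sub
        (hg.continuous.comp_aestronglyMeasurable hu'.aestronglyMeasurable)
    have hi1 : ∀ m, Integrable fun x => fderiv ℝ φ x e * g (U' m x) := fun m =>
      (hφd.mul (hgU m).continuous).integrable_of_hasCompactSupport hφdc.mul_right
    have hi2 : ∀ m, Integrable fun x => fderiv ℝ φ x e * (g (U' m x) - g (u' x)) := fun m =>
      (hdiff m).bdd_mul hφd.aestronglyMeasurable (ae_of_all _ hCd)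
    have h0 : Tendsto (fun m => ∫ x, fderiv ℝ φ x e * (g (U' m x) - g (u' x))) atTop (𝓝 0) := by
      refine squeeze_zero_norm (fun m => ?_) (by simpa using hL1.const_mul (Cd * C))
      rw [← integral_const_mul]
      refine (norm_integral_le_integral_norm _).trans
        (integral_mono (hi2 m).norm (((hUi m).sub hu').abs.const_mul (Cd * C)) fun x => ?_)
      simp only [norm_mul, Real.norm_eq_abs, mul_assoc]
      exact mul_le_mul (hCd x) (lipschitz_of_deriv_le hg hC _ _) (abs_nonneg _)
        ((norm_nonneg _).trans (hCd x))
    have h1 : Tendsto (fun m => (∫ x, fderiv ℝ φ x e * g (u' x)) +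
        ∫ x, fderiv ℝ φ x e * (g (U' m x) - g (u' x))) atTop
        (𝓝 ((∫ x, fderiv ℝ φ x e * g (u' x)) + 0)) := h0.const_add _
    rw [add_zero] at h1
    refine h1.congr fun m => ?_
    have hi3 : Integrable fun x => fderiv ℝ φ x e * g (u' x) := by
      refine ((hi1 m).sub (hi2 m)).congr (ae_of_all _ fun x => ?_)
      simp only [Pi.sub_apply]
      ring
    rw [← integral_add hi3 (hi2 m)]
    exact integral_congr_ae (ae_of_all _ fun x => by ring)
  exact tendsto_nhds_unique limL (limR.neg.congr fun m => (parts m).symm)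

theorem _root_.MeasureTheory.MemLp.comp_of_deriv_le {α : Type*} [MeasurableSpace α]
    {μ : Measure α} [IsFiniteMeasure μ] {p : ℝ≥0∞} {u : α → ℝ} (hu : MemLp u p μ) {g : ℝ → ℝ}
    {C : ℝ} (hg : ContDiff ℝ 1 g) (hC : ∀ s, |deriv g s| ≤ C) :
    MemLp (fun x => g (u x)) p μ := by
  have h0 : MemLp (fun _ : α => |g 0|) p μ := memLp_const _
  have h1 : MemLp (fun x => C * |u x|) p μ := hu.abs.const_mul C
  refine (h0.add h1).mono (hg.continuous.comp_aestronglyMeasurable hu.1) (ae_of_all _ fun x => ?_)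
  have h := lipschitz_of_deriv_le hg hC (u x) 0
  rw [sub_zero] at h
  have h' := abs_sub_abs_le_abs_sub (g (u x)) (g 0)
  simp only [Real.norm_eq_abs, Pi.add_apply]
  exact le_trans (by linarith) (le_abs_self _)

theorem hasWeakPartial_comp {U : Set (Vec n)} (hU : IsOpen U) (hUb : Bornology.IsBounded U)
    {u w : Vec n → ℝ} (hu : MemLp u 2 (volume.restrict U)) (hw2 : MemLp w 2 (volume.restrict U))
    {i : Fin n} (hw : HasWeakPartial U ![i] u w) {g : ℝ → ℝ} {C : ℝ} (hg : ContDiff ℝ 1 g)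
    (hC : ∀ s, |deriv g s| ≤ C) :
    MemLp (fun x => g (u x)) 2 (volume.restrict U) ∧
    MemLp (fun x => deriv g (u x) * w x) 2 (volume.restrict U) ∧
    HasWeakPartial U ![i] (fun x => g (u x)) (fun x => deriv g (u x) * w x) := by
  have : IsFiniteMeasure (volume.restrict U) := ⟨by simpa using hUb.measure_lt_top⟩
  have hg' : Continuous (deriv g) := hg.continuous_deriv (by norm_num)
  have h1 := hu.comp_of_deriv_le hg hC
  have h2 : MemLp (fun x => deriv g (u x) * w x) 2 (volume.restrict U) := by
    have hb : MemLp (fun x => C * |w x|) 2 (volume.restrict U) := hw2.abs.const_mul C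
    refine hb.mono
      ((hg'.comp_aestronglyMeasurable hu.1).mul hw2.1) (ae_of_all _ fun x => ?_)
    simp only [Real.norm_eq_abs, abs_mul, abs_abs]
    exact mul_le_mul_of_nonneg_right ((hC _).trans (le_abs_self _)) (abs_nonneg _)
  refine ⟨h1, h2, ?_, ?_, fun φ hφ hφc hφU => ?_⟩
  · exact IntegrableOn.locallyIntegrableOn (h1.integrable (by norm_num))
  · exact IntegrableOn.locallyIntegrableOn (h2.integrable (by norm_num))
  · simp only [classicalPartial_one, smul_eq_mul, pow_one, neg_mul, one_mul]
    exact integral_comp_of_hasWeakPartial hU hw hg hC hφ hφc hφU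

theorem memSobolev_one_iff {U : Set (Vec n)} {p : ℝ≥0∞} {f : Vec n → ℝ}
    (hf : MemLp f p (volume.restrict U)) (hf1 : LocallyIntegrableOn f U)
    (h : ∀ i : Fin n, ∃ g, MemLp g p (volume.restrict U) ∧ HasWeakPartial U ![i] f g) :
    MemSobolev U 1 p f := by
  refine ⟨hf, fun m hm s => ?_⟩
  interval_cases m
  · refine ⟨f, hf, hf1, hf1, fun φ _ _ _ => ?_⟩
    simp [classicalPartial]
  · obtain ⟨g, hg⟩ := h (s 0)
    refine ⟨g, ?_⟩
    have : s = ![s 0] := by ext j; fin_cases j; rfl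
    rw [this]
    exact hg

theorem MemSobolev.comp {U : Set (Vec n)} (hU : IsOpen U) (hUb : Bornology.IsBounded U)
    {u : Vec n → ℝ} (hu : MemSobolev U 1 2 u) {g : ℝ → ℝ} {C : ℝ} (hg : ContDiff ℝ 1 g)
    (hC : ∀ s, |deriv g s| ≤ C) :
    MemSobolev U 1 2 (fun x => g (u x)) ∧
    ∀ i : Fin n, weakPartial U ![i] (fun x => g (u x)) =ᵐ[volume.restrict U]
      fun x => deriv g (u x) * weakPartial U ![i] u x := by
  have : IsFiniteMeasure (volume.restrict U) := ⟨by simpa using hUb.measure_lt_top⟩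
  have key := fun i : Fin n => hasWeakPartial_comp hU hUb hu.1
    (hu.memLp_weakPartial hU le_rfl ![i]) (hu.hasWeakPartial le_rfl ![i]) hg hC
  refine ⟨?_, fun i => (key i).2.2.weakPartial_ae_eq hU⟩
  have h1 := hu.1.comp_of_deriv_le hg hC
  exact memSobolev_one_iff h1 (IntegrableOn.locallyIntegrableOn (h1.integrable (by norm_num)))
    fun i => ⟨_, (key i).2.1, (key i).2.2⟩

end ChainRule
end FSI

namespace FSI
open Filter Topology

/-! ### Convexity in one variable -/

section Convexity

theorem tangent_le_of_monotoneOn {S : Set ℝ} (hS : S.OrdConnected) {F F' : ℝ → ℝ}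
    (hF : ∀ s ∈ S, HasDerivAt F (F' s) s) (hF' : MonotoneOn F' S) {s t : ℝ} (hs : s ∈ S)
    (ht : t ∈ S) : F s + F' s * (t - s) ≤ F t := by
  rcases lt_trichotomy s t with h | h | h
  · have hsub : Icc s t ⊆ S := hS.out hs ht
    obtain ⟨c, hc, hce⟩ := exists_hasDerivAt_eq_slope F F' h
      (fun x hx => (hF x (hsub hx)).continuousAt.continuousWithinAt)
      (fun x hx => hF x (hsub (Ioo_subset_Icc_self hx)))
    have h1 := hF' hs (hsub (Ioo_subset_Icc_self hc)) hc.1.le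
    rw [hce, le_div_iff₀ (by linarith)] at h1
    linarith
  · subst h; simp
  · have hsub : Icc t s ⊆ S := hS.out ht hs
    obtain ⟨c, hc, hce⟩ := exists_hasDerivAt_eq_slope F F' h
      (fun x hx => (hF x (hsub hx)).continuousAt.continuousWithinAt)
      (fun x hx => hF x (hsub (Ioo_subset_Icc_self hx)))
    have h1 := hF' (hsub (Ioo_subset_Icc_self hc)) hs hc.2.le
    rw [hce, div_le_iff₀ (by linarith)] at h1
    nlinarith

theorem monotoneOn_of_hasDerivAt_nonneg {S : Set ℝ} (hS : S.OrdConnected) {F F' : ℝ → ℝ}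
    (hF : ∀ s ∈ S, HasDerivAt F (F' s) s) (hF' : ∀ s ∈ S, 0 ≤ F' s) : MonotoneOn F S :=
  monotoneOn_of_hasDerivWithinAt_nonneg (f' := F') hS.convex
    (fun x hx => (hF x hx).continuousAt.continuousWithinAt)
    (fun x hx => (hF x (interior_subset hx)).hasDerivWithinAt)
    (fun x hx => hF' x (interior_subset hx))

/-- Applied to differences, this is the comparison principle behind all pointwise bounds on
potentials below: ordered second derivatives and second-order contact at one point give ordered
functions. -/
theorem nonneg_of_hasDerivAt_two_nonneg {S : Set ℝ} (hS : S.OrdConnected) {F F' F'' : ℝ → ℝ}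
    (hF : ∀ s ∈ S, HasDerivAt F (F' s) s) (hF' : ∀ s ∈ S, HasDerivAt F' (F'' s) s)
    (hF'' : ∀ s ∈ S, 0 ≤ F'' s) {a : ℝ} (ha : a ∈ S) (h0 : F a = 0) (h1 : F' a = 0)
    {s : ℝ} (hs : s ∈ S) : 0 ≤ F s := by
  have := tangent_le_of_monotoneOn hS hF (monotoneOn_of_hasDerivAt_nonneg hS hF' hF'') ha hs
  simpa [h0, h1] using this

end Convexity

/-! ### The Neumann resolvent -/

section Neumann

variable {n : ℕ} {U : Set (Vec n)} {a : ℝ} {f u : Vec n → ℝ}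

theorem weakGradSq_one (U : Set (Vec n)) (u : Vec n → ℝ) (x : Vec n) :
    weakGradSq U 1 u x = ∑ i : Fin n, weakPartial U ![i] u x ^ 2 := by
  rw [weakGradSq]
  refine Fintype.sum_equiv (Equiv.funUnique (Fin 1) (Fin n)) _ _ fun s => ?_
  have : s = ![s 0] := by ext j; fin_cases j; rfl
  rw [Real.norm_eq_abs, sq_abs]
  congr 2

theorem weakGradSq_nonneg {F : Type*} [NormedAddCommGroup F] [NormedSpace ℝ F]
    (U : Set (Vec n)) (k : ℕ) (u : Vec n → F) (x : Vec n) :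
    0 ≤ weakGradSq U k u x := Finset.sum_nonneg fun _ _ => by positivity

theorem MemSobolev.integrable_weakGradSq_one (hU : IsOpen U) (hu : MemSobolev U 1 2 u) :
    Integrable (weakGradSq U 1 u) (volume.restrict U) := by
  have : weakGradSq U 1 u = fun x => ∑ i : Fin n, weakPartial U ![i] u x ^ 2 :=
    funext fun x => weakGradSq_one U u x
  rw [this]
  exact integrable_finsetSum _ fun i _ => (hu.memLp_weakPartial hU le_rfl ![i]).integrable_sq

/-- The test function is g(u), for which the chain rule gives ∇u · ∇g(u) = g'(u)|∇u|². -/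
theorem IsNeumannResolvent.test (hU : IsOpen U) (hUb : Bornology.IsBounded U)
    (h : IsNeumannResolvent U a f u) {g : ℝ → ℝ} {C : ℝ} (hg : ContDiff ℝ 1 g)
    (hC : ∀ s, |deriv g s| ≤ C) :
    (∫ x in U, u x * g (u x)) + a * (∫ x in U, deriv g (u x) * weakGradSq U 1 u x) =
      ∫ x in U, f x * g (u x) := by
  obtain ⟨h1, h2⟩ := h.1.comp hU hUb hg hC
  rw [← h.2 _ h1]
  congr 2
  have h3 : ∀ᵐ x ∂volume.restrict U, ∀ i : Fin n,
      weakPartial U ![i] (fun x => g (u x)) x = deriv g (u x) * weakPartial U ![i] u x :=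
    ae_all_iff.2 h2
  refine integral_congr_ae ?_
  filter_upwards [h3] with x hx
  rw [weakGradSq_one, weakGradDot, Finset.mul_sum]
  exact Finset.sum_congr rfl fun i _ => by rw [hx]; ring

theorem IsNeumannResolvent.integral_eq (hU : IsOpen U) (hUb : Bornology.IsBounded U)
    (h : IsNeumannResolvent U a f u) : ∫ x in U, u x = ∫ x in U, f x := by
  simpa using h.test hU hUb (g := fun _ => 1) (C := 0) contDiff_const (by simp)

/-- Testing with the increasing function sigmoid(m u) − 1 = −σ_m(u) and dropping the gradient term
gives ∫ σ_m(u) f ≤ ∫ σ_m(u) u. As m → ∞, σ_m tends to κ, so that 0 ≤ ∫ κ(u) f ≤ ∫ κ(u) u ≤ 0. Since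
f > 0, κ(u) vanishes almost everywhere. -/
theorem IsNeumannResolvent.ae_pos (hU : IsOpen U) (hUb : Bornology.IsBounded U) (ha : 0 ≤ a)
    (h : IsNeumannResolvent U a f u) (hfi : Integrable f (volume.restrict U))
    (hf : ∀ᵐ x ∂volume.restrict U, 0 < f x) : ∀ᵐ x ∂volume.restrict U, 0 < u x := by
  have : IsFiniteMeasure (volume.restrict U) := ⟨by simpa using hUb.measure_lt_top⟩
  have hui : Integrable u (volume.restrict U) := h.1.1.integrable (by norm_num)
  let σ : ℕ → ℝ → ℝ := fun m s => 1 - Real.sigmoid (m * s)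
  -- The value 1/2 at 0 is sigmoid 0; being nonzero, it excludes u = 0 and yields strict positivity.
  let κ : ℝ → ℝ := fun s => if 0 < s then 0 else if s = 0 then 1 / 2 else 1
  have hσc : ∀ m, Continuous (σ m) := fun m =>
    continuous_const.sub (continuous_sigmoid.comp (continuous_const.mul continuous_id))
  have hσb : ∀ m s, |σ m s| ≤ 1 := fun m s => by
    have h1 := Real.sigmoid_pos (m * s)
    have h2 := Real.sigmoid_lt_one (m * s)
    rw [abs_le]; constructor <;> simp only [σ] <;> linarith
  have hσd : ∀ (m : ℕ) s, HasDerivAt (fun s => Real.sigmoid (m * s) - 1)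
      (Real.sigmoid (m * s) * (1 - Real.sigmoid (m * s)) * m) s := fun m s => by
    have h1 : HasDerivAt (fun s : ℝ => (m : ℝ) * s) m s := by
      simpa using (hasDerivAt_id s).const_mul (m : ℝ)
    exact ((Real.hasDerivAt_sigmoid _).comp s h1).sub_const 1
  have hineq : ∀ m : ℕ, ∫ x in U, σ m (u x) * f x ≤ ∫ x in U, σ m (u x) * u x := fun m => by
    have hb : ∀ s, 0 ≤ Real.sigmoid (m * s) * (1 - Real.sigmoid (m * s)) * m ∧
        Real.sigmoid (m * s) * (1 - Real.sigmoid (m * s)) * m ≤ m := fun s => by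
      have h1 := Real.sigmoid_pos (m * s)
      have h2 := Real.sigmoid_lt_one (m * s)
      have h3 : 0 ≤ Real.sigmoid (m * s) * (1 - Real.sigmoid (m * s)) :=
        mul_nonneg h1.le (by linarith)
      have h4 : Real.sigmoid (m * s) * (1 - Real.sigmoid (m * s)) ≤ 1 := by nlinarith
      have h5 : (0 : ℝ) ≤ m := Nat.cast_nonneg m
      exact ⟨mul_nonneg h3 h5, by nlinarith⟩
    have hT := h.test hU hUb (g := fun s => Real.sigmoid (m * s) - 1) (C := m)
      (((contDiff_sigmoid.of_le le_top).comp (contDiff_const.mul contDiff_id)).sub contDiff_const)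
      (fun s => by rw [(hσd m s).deriv, abs_of_nonneg (hb s).1]; exact (hb s).2)
    have hpos : 0 ≤ a * ∫ x in U, deriv (fun s => Real.sigmoid (m * s) - 1) (u x) *
        weakGradSq U 1 u x :=
      mul_nonneg ha (integral_nonneg fun x =>
        mul_nonneg (by rw [(hσd m _).deriv]; exact (hb _).1) (weakGradSq_nonneg _ _ _ _))
    have e1 : ∀ v : Vec n → ℝ, ∫ x in U, v x * (Real.sigmoid (m * u x) - 1) =
        - ∫ x in U, σ m (u x) * v x := fun v => by
      rw [← integral_neg]
      exact integral_congr_ae (ae_of_all _ fun x => by simp only [σ]; ring)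
    rw [e1, e1] at hT
    linarith
  have hlim : ∀ s : ℝ, Tendsto (fun m => σ m s) atTop (𝓝 (κ s)) := fun s => by
    have hm : Tendsto (fun m : ℕ => (m : ℝ)) atTop atTop := tendsto_natCast_atTop_atTop
    rcases lt_trichotomy s 0 with hs | hs | hs
    · have : Tendsto (fun m : ℕ => (m : ℝ) * s) atTop atBot := hm.atTop_mul_const_of_neg hs
      have := (tendsto_const_nhds (x := (1 : ℝ))).sub (Real.tendsto_sigmoid_atBot.comp this)
      simpa [σ, κ, hs.not_gt, hs.ne] using this
    · subst hs
      have : (1 : ℝ) - 2⁻¹ = 2⁻¹ := by norm_num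
      simp [σ, κ, this, Real.sigmoid_zero]
    · have : Tendsto (fun m : ℕ => (m : ℝ) * s) atTop atTop := hm.atTop_mul_const hs
      have := (tendsto_const_nhds (x := (1 : ℝ))).sub (Real.tendsto_sigmoid_atTop.comp this)
      simpa [σ, κ, hs] using this
  have hL : ∀ v : Vec n → ℝ, Integrable v (volume.restrict U) →
      Tendsto (fun m => ∫ x in U, σ m (u x) * v x) atTop (𝓝 (∫ x in U, κ (u x) * v x)) := by
    intro v hv
    refine tendsto_integral_of_dominated_convergence (fun x => |v x|)
      (fun m => ((hσc m).comp_aestronglyMeasurable h.1.1.1).mul hv.1) hv.abs ?_ ?_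
    · refine fun m => ae_of_all _ fun x => ?_
      rw [Real.norm_eq_abs, abs_mul]
      exact mul_le_of_le_one_left (abs_nonneg _) (hσb m _)
    · exact ae_of_all _ fun x => (hlim _).mul_const _
  have hle := le_of_tendsto_of_tendsto' (hL f hfi) (hL u hui) hineq
  have hκ0 : ∀ s, 0 ≤ κ s := fun s => by simp only [κ]; split_ifs <;> norm_num
  have hκm : Measurable κ := by
    refine Measurable.ite measurableSet_Ioi measurable_const ?_
    exact Measurable.ite (measurableSet_singleton 0) measurable_const measurable_const
  have hneg : ∫ x in U, κ (u x) * u x ≤ 0 := by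
    refine integral_nonpos fun x => ?_
    simp only [κ, Pi.zero_apply]
    split_ifs with h1 h2
    · simp
    · simp [h2]
    · simpa using h1
  have hnn : 0 ≤ᵐ[volume.restrict U] fun x => κ (u x) * f x := by
    filter_upwards [hf] with x hx using mul_nonneg (hκ0 _) hx.le
  have hki : Integrable (fun x => κ (u x) * f x) (volume.restrict U) := by
    refine hfi.bdd_mul (c := 1) (hκm.comp_aemeasurable hui.1.aemeasurable).aestronglyMeasurable
      (ae_of_all _ fun x => ?_)
    rw [Real.norm_eq_abs, abs_of_nonneg (hκ0 _)]
    simp only [κ]; split_ifs <;> norm_num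
  have hz := (integral_eq_zero_iff_of_nonneg_ae hnn hki).1
    (le_antisymm (hle.trans hneg) (integral_nonneg_of_ae hnn))
  filter_upwards [hz, hf] with x hx hfx
  by_contra hcon
  simp only [Pi.zero_apply, mul_eq_zero, hfx.ne', or_false, κ, if_neg hcon] at hx
  split_ifs at hx <;> norm_num at hx

end Neumann
end FSI

namespace FSI
open Filter Topology

/-! ### Convex functionals of the Neumann resolvent -/

section ConvexEstimate

/-- A convex function on `(0,∞)` with double zero at `1` is approximated from below by convex
functions on `ℝ` of linear growth that agree with it on a given compact interval. -/
theorem exists_convex_truncation {K K' θ : ℝ → ℝ} (hK : ∀ s, 0 < s → HasDerivAt K (K' s) s)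
    (hK' : ∀ s, 0 < s → HasDerivAt K' (θ s) s) (hθ : ContinuousOn θ (Ioi 0))
    (hθ0 : ∀ s, 0 < s → 0 ≤ θ s) (h0 : K 1 = 0) (h1 : K' 1 = 0) {r : ℝ} (hr : 1 ≤ r) :
    ∃ T g G : ℝ → ℝ, Continuous T ∧ (∀ s, 0 ≤ T s) ∧ (∃ C, ∀ s, |T s| ≤ C) ∧
      (∃ C, ∀ s, |g s| ≤ C) ∧ (∀ s, HasDerivAt g (T s) s) ∧ (∀ s, HasDerivAt G (g s) s) ∧
      (∀ s, 0 ≤ G s) ∧ (∀ s, 0 < s → G s ≤ K s) ∧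
      ∀ s ∈ Icc r⁻¹ r, T s = θ s ∧ G s = K s := by
  have hr0 : 0 < r := by linarith
  set b : ℝ := (2 * r)⁻¹ with hb
  have hb0 : 0 < b := by positivity
  have hbr : 2 * r * b = 1 := by rw [hb]; field_simp
  -- A piecewise linear cutoff, equal to 1 on [1/r, r] and to 0 outside [b, r + 1]; the ramp 2rs − 1
  -- vanishes at s = b and reaches 1 at s = 1/r.
  let χ : ℝ → ℝ := fun s => max 0 (min 1 (min (2 * r * s - 1) (r + 1 - s)))
  have hχc : Continuous χ := by fun_prop
  have hχ0 : ∀ s, 0 ≤ χ s := fun s => le_max_left _ _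
  have hχ1 : ∀ s, χ s ≤ 1 := fun s => max_le zero_le_one (min_le_left _ _)
  have hχr : ∀ s ∈ Icc r⁻¹ r, χ s = 1 := fun s hs => by
    have : 1 ≤ r * s := by
      have := mul_le_mul_of_nonneg_left hs.1 hr0.le
      rwa [mul_inv_cancel₀ hr0.ne'] at this
    have h2 : 1 ≤ 2 * r * s - 1 := by linarith
    have h3 : 1 ≤ r + 1 - s := by linarith [hs.2]
    simp [χ, min_eq_left (le_min h2 h3)]
  have hχz : ∀ s, s ∉ Icc b (r + 1) → χ s = 0 := fun s hs => by
    simp only [χ, max_eq_left_iff]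
    rw [mem_Icc, not_and_or, not_le, not_le] at hs
    rcases hs with h | h
    · refine (min_le_right _ _).trans ((min_le_left _ _).trans ?_)
      nlinarith
    · exact (min_le_right _ _).trans ((min_le_right _ _).trans (by linarith))
  -- Replacing s by max s b keeps the argument of θ in (0,∞) and changes it only where χ vanishes,
  -- so T is continuous on all of ℝ.
  let T : ℝ → ℝ := fun s => χ s * θ (max s b)
  have hTc : Continuous T := by
    refine hχc.mul (hθ.comp_continuous (by fun_prop) fun s => ?_)
    exact lt_of_lt_of_le hb0 (le_max_right _ _)
  have hT0 : ∀ s, 0 ≤ T s := fun s =>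
    mul_nonneg (hχ0 s) (hθ0 _ (lt_of_lt_of_le hb0 (le_max_right _ _)))
  have hTs : HasCompactSupport T :=
    HasCompactSupport.intro (isCompact_Icc (a := b) (b := r + 1)) fun s hs => by
      simp [T, hχz s hs]
  have hTeq : ∀ s, 0 < s → T s = χ s * θ s := fun s hs => by
    by_cases h : s ∈ Icc b (r + 1)
    · simp only [T, max_eq_left h.1]
    · simp [T, hχz s h]
  have hTi : Integrable T := hTc.integrable_of_hasCompactSupport hTs
  let g : ℝ → ℝ := fun s => ∫ t in (1 : ℝ)..s, T t
  have hg : ∀ s, HasDerivAt g (T s) s := fun s => hTc.integral_hasStrictDerivAt 1 s |>.hasDerivAt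
  have hgc : Continuous g := continuous_iff_continuousAt.2 fun s => (hg s).continuousAt
  let G : ℝ → ℝ := fun s => ∫ t in (1 : ℝ)..s, g t
  have hG : ∀ s, HasDerivAt G (g s) s := fun s => hgc.integral_hasStrictDerivAt 1 s |>.hasDerivAt
  have hg1 : g 1 = 0 := intervalIntegral.integral_same
  have hG1 : G 1 = 0 := intervalIntegral.integral_same
  have hrm : ∀ s ∈ Icc r⁻¹ r, 0 < s := fun s hs => lt_of_lt_of_le (inv_pos.2 hr0) hs.1
  have hle : ∀ s, 0 < s → G s ≤ K s := fun s hs => by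
    -- The second derivative of K − G is (1 − χ)θ ≥ 0.
    have := nonneg_of_hasDerivAt_two_nonneg (S := Ioi 0) ordConnected_Ioi
      (F := fun s => K s - G s) (fun s hs => (hK s hs).sub (hG s))
      (fun s hs => (hK' s hs).sub (hg s))
      (fun s hs => by
        rw [hTeq s hs]
        nlinarith [hχ1 s, hθ0 s hs])
      (a := 1) (mem_Ioi.2 one_pos) (by simp [h0, hG1]) (by simp [h1, hg1]) hs
    linarith
  refine ⟨T, g, G, hTc, hT0, ?_, ⟨∫ t, |T t|, fun s => ?_⟩, hg, hG, fun s => ?_, hle, ?_⟩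
  · exact hTs.exists_bound_of_continuous hTc
  · refine (intervalIntegral.norm_integral_le_integral_norm_uIoc (f := T)).trans ?_
    exact setIntegral_le_integral hTi.norm (ae_of_all _ fun t => norm_nonneg _)
  · exact nonneg_of_hasDerivAt_two_nonneg (S := univ) ordConnected_univ (fun s _ => hG s)
      (fun s _ => hg s) (fun s _ => hT0 s) (mem_univ 1) hG1 hg1 (mem_univ s)
  · intro s hs
    refine ⟨by rw [hTeq s (hrm s hs), hχr s hs, one_mul], le_antisymm (hle s (hrm s hs)) ?_⟩
    -- Where χ = 1 this second derivative is zero, so the reverse inequality holds as well.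
    have := nonneg_of_hasDerivAt_two_nonneg (S := Icc r⁻¹ r) ordConnected_Icc
      (F := fun s => G s - K s) (fun s hs => (hG s).sub (hK s (hrm s hs)))
      (fun s hs => (hg s).sub (hK' s (hrm s hs)))
      (fun s hs => by rw [hTeq s (hrm s hs), hχr s hs]; simp)
      (a := 1) ⟨inv_le_one_of_one_le₀ hr, hr⟩ (by simp [h0, hG1]) (by simp [h1, hg1]) hs
    linarith

variable {n : ℕ} {U : Set (Vec n)} {a : ℝ} {f u : Vec n → ℝ}

theorem aestronglyMeasurable_comp_of_continuousOn_Ioi {α : Type*} [MeasurableSpace α]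
    {μ : Measure α} {u : α → ℝ} (hu : AEStronglyMeasurable u μ) (hpos : ∀ᵐ x ∂μ, 0 < u x)
    {K : ℝ → ℝ} (hK : ContinuousOn K (Ioi 0)) : AEStronglyMeasurable (fun x => K (u x)) μ := by
  have hm : Measurable ((Ioi (0 : ℝ)).piecewise K fun _ => 0) :=
    hK.measurable_piecewise continuousOn_const measurableSet_Ioi
  refine (hm.comp_aemeasurable hu.aemeasurable).aestronglyMeasurable.congr ?_
  filter_upwards [hpos] with x hx
  simp [Set.piecewise, hx]

/-- Test with g(u), where g = G', and integrate the tangent inequality G(u) + g(u)(f − u) ≤ G(f).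
Boundedness of T = g' makes g(u) admissible; boundedness of g makes G Lipschitz, hence G(u) and G(f)
integrable. -/
theorem IsNeumannResolvent.integral_convex_le (hU : IsOpen U) (hUb : Bornology.IsBounded U)
    (h : IsNeumannResolvent U a f u) (hf : Integrable f (volume.restrict U)) {T g G : ℝ → ℝ}
    {C C' : ℝ} (hT : Continuous T) (hTC : ∀ s, |T s| ≤ C) (hgC : ∀ s, |g s| ≤ C')
    (hT0 : ∀ s, 0 ≤ T s)
    (hg : ∀ s, HasDerivAt g (T s) s) (hG : ∀ s, HasDerivAt G (g s) s) :
    Integrable (fun x => G (u x)) (volume.restrict U) ∧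
    Integrable (fun x => G (f x)) (volume.restrict U) ∧
    Integrable (fun x => T (u x) * weakGradSq U 1 u x) (volume.restrict U) ∧
    (∫ x in U, G (u x)) + a * (∫ x in U, T (u x) * weakGradSq U 1 u x) ≤
      ∫ x in U, G (f x) := by
  have : IsFiniteMeasure (volume.restrict U) := ⟨by simpa using hUb.measure_lt_top⟩
  have hui : Integrable u (volume.restrict U) := h.1.1.integrable (by norm_num)
  have hdg : deriv g = T := funext fun s => (hg s).deriv
  have hdG : deriv G = g := funext fun s => (hG s).deriv
  have hg1 : ContDiff ℝ 1 g := by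
    rw [contDiff_one_iff_deriv, hdg]
    exact ⟨fun s => (hg s).differentiableAt, hT⟩
  have hG1 : ContDiff ℝ 1 G := by
    rw [contDiff_one_iff_deriv, hdG]
    exact ⟨fun s => (hG s).differentiableAt, hg1.continuous⟩
  have hG1C : ∀ s, |deriv G s| ≤ C' := by rw [hdG]; exact hgC
  have hcomp : ∀ v : Vec n → ℝ, Integrable v (volume.restrict U) →
      Integrable (fun x => G (v x)) (volume.restrict U) := fun v hv =>
    memLp_one_iff_integrable.1 ((memLp_one_iff_integrable.2 hv).comp_of_deriv_le hG1 hG1C)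
  have hgm : AEStronglyMeasurable (fun x => g (u x)) (volume.restrict U) :=
    hg1.continuous.comp_aestronglyMeasurable hui.1
  have hgi : ∀ v : Vec n → ℝ, Integrable v (volume.restrict U) →
      Integrable (fun x => v x * g (u x)) (volume.restrict U) := fun v hv =>
    hv.mul_bdd hgm (ae_of_all _ fun x => hgC (u x))
  have hTi : Integrable (fun x => T (u x) * weakGradSq U 1 u x) (volume.restrict U) :=
    (h.1.integrable_weakGradSq_one hU).bdd_mul (hT.comp_aestronglyMeasurable hui.1)
      (ae_of_all _ fun x => hTC (u x))
  refine ⟨hcomp u hui, hcomp f hf, hTi, ?_⟩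
  have htest := h.test hU hUb hg1 (C := C) (by rw [hdg]; exact hTC)
  rw [hdg] at htest
  have hmono : MonotoneOn g univ :=
    monotoneOn_of_hasDerivAt_nonneg ordConnected_univ (fun s _ => hg s) fun s _ => hT0 s
  have hpt : ∀ x, G (u x) + (f x * g (u x) - u x * g (u x)) ≤ G (f x) := fun x => by
    have := tangent_le_of_monotoneOn ordConnected_univ (fun s _ => hG s) hmono
      (mem_univ (u x)) (mem_univ (f x))
    linarith
  have hsub : Integrable (fun x => f x * g (u x) - u x * g (u x)) (volume.restrict U) :=
    (hgi f hf).sub (hgi u hui)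
  have hI := integral_mono ((hcomp u hui).add hsub) (hcomp f hf) hpt
  simp only [Pi.add_apply] at hI
  rw [integral_add (hcomp u hui) hsub, integral_sub (hgi f hf) (hgi u hui)] at hI
  linarith

/-- The truncations stay below K, so the right-hand sides are bounded uniformly by ∫ K(f). As u > 0,
they agree with K and θ at u(x) for all large m, and Fatou yields both the integrability and the
inequality. -/
theorem IsNeumannResolvent.convex_estimate (hU : IsOpen U) (hUb : Bornology.IsBounded U)
    (ha : 0 < a) (h : IsNeumannResolvent U a f u) (hf : Integrable f (volume.restrict U))
    (hfpos : ∀ᵐ x ∂volume.restrict U, 0 < f x)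
    {K K' θ : ℝ → ℝ} (hK : ∀ s, 0 < s → HasDerivAt K (K' s) s)
    (hK' : ∀ s, 0 < s → HasDerivAt K' (θ s) s) (hθ : ContinuousOn θ (Ioi 0))
    (hθ0 : ∀ s, 0 < s → 0 ≤ θ s) (h0 : K 1 = 0) (h1 : K' 1 = 0)
    (hKf : Integrable (fun x => K (f x)) (volume.restrict U)) :
    Integrable (fun x => K (u x)) (volume.restrict U) ∧
    Integrable (fun x => θ (u x) * weakGradSq U 1 u x) (volume.restrict U) ∧
    (∫ x in U, K (u x)) + a * (∫ x in U, θ (u x) * weakGradSq U 1 u x) ≤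
      ∫ x in U, K (f x) := by
  have hupos := h.ae_pos hU hUb ha.le hf hfpos
  have hum : AEStronglyMeasurable u (volume.restrict U) := h.1.1.1
  have hKc : ContinuousOn K (Ioi 0) := fun s hs => (hK s hs).continuousAt.continuousWithinAt
  have hW := (h.1.integrable_weakGradSq_one hU)
  have hK0 : ∀ s, 0 < s → 0 ≤ K s := fun s hs =>
    nonneg_of_hasDerivAt_two_nonneg ordConnected_Ioi hK hK' hθ0 (mem_Ioi.2 one_pos) h0 h1 hs
  have hKum := aestronglyMeasurable_comp_of_continuousOn_Ioi hum hupos hKc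
  have hθum : AEStronglyMeasurable (fun x => θ (u x) * weakGradSq U 1 u x)
      (volume.restrict U) :=
    (aestronglyMeasurable_comp_of_continuousOn_Ioi hum hupos hθ).mul hW.1
  choose T g G hT hT0 hTC hgC hg hG hG0 hGK hEq using fun m : ℕ =>
    exists_convex_truncation hK hK' hθ hθ0 h0 h1 (r := (m : ℝ) + 1)
      (by linarith [(Nat.cast_nonneg m : (0 : ℝ) ≤ m)])
  have est := fun m : ℕ =>
    h.integral_convex_le hU hUb hf (hT m) (hTC m).choose_spec (hgC m).choose_spec (hT0 m)
      (hg m) (hG m)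
  let Φ : ℕ → Vec n → ℝ := fun m x => G m (u x) + a * (T m (u x) * weakGradSq U 1 u x)
  have hΦi : ∀ m, Integrable (Φ m) (volume.restrict U) := fun m =>
    (est m).1.add ((est m).2.2.1.const_mul a)
  have hΦ0 : ∀ m x, 0 ≤ Φ m x := fun m x =>
    add_nonneg (hG0 m _) (mul_nonneg ha.le (mul_nonneg (hT0 m _) (weakGradSq_nonneg _ _ _ _)))
  have hΦle : ∀ m, ∫ x in U, Φ m x ≤ ∫ x in U, K (f x) := fun m => by
    have e : ∫ x in U, Φ m x =
        (∫ x in U, G m (u x)) + a * ∫ x in U, T m (u x) * weakGradSq U 1 u x := by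
      rw [← integral_const_mul, ← integral_add (est m).1 ((est m).2.2.1.const_mul a)]
    rw [e]
    refine (est m).2.2.2.trans (integral_mono_ae (est m).2.1 hKf ?_)
    filter_upwards [hfpos] with x hx using hGK m _ hx
  -- Both summands are nonnegative, so one application of Fatou to the sum suffices; they are
  -- separated after its integrability is known.
  let Φ' : Vec n → ℝ := fun x => K (u x) + a * (θ (u x) * weakGradSq U 1 u x)
  have hev : ∀ᵐ x ∂volume.restrict U, ∀ᶠ m in atTop, Φ m x = Φ' x := by
    filter_upwards [hupos] with x hx
    have hm : Tendsto (fun m : ℕ => (m : ℝ) + 1) atTop atTop :=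
      tendsto_atTop_add_const_right _ _ tendsto_natCast_atTop_atTop
    filter_upwards [hm.eventually_ge_atTop (u x), hm.eventually_ge_atTop (u x)⁻¹] with m h1 h2
    have hmem : u x ∈ Icc ((m : ℝ) + 1)⁻¹ ((m : ℝ) + 1) :=
      ⟨(inv_le_comm₀ hx (by positivity)).1 h2, h1⟩
    simp only [Φ, Φ', (hEq m _ hmem).1, (hEq m _ hmem).2]
  have hΦ'0 : 0 ≤ᵐ[volume.restrict U] Φ' := by
    filter_upwards [hupos] with x hx
    exact add_nonneg (hK0 _ hx)
      (mul_nonneg ha.le (mul_nonneg (hθ0 _ hx) (weakGradSq_nonneg _ _ _ _)))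
  have hΦ'm : AEStronglyMeasurable Φ' (volume.restrict U) := hKum.add (hθum.const_mul a)
  have hKf0 : 0 ≤ ∫ x in U, K (f x) := by
    refine integral_nonneg_of_ae ?_
    filter_upwards [hfpos] with x hx using hK0 _ hx
  have hlin : ∫⁻ x in U, ENNReal.ofReal (Φ' x) ≤ ENNReal.ofReal (∫ x in U, K (f x)) := by
    calc ∫⁻ x in U, ENNReal.ofReal (Φ' x)
        = ∫⁻ x in U, liminf (fun m => ENNReal.ofReal (Φ m x)) atTop := by
          refine lintegral_congr_ae ?_
          filter_upwards [hev] with x hx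
          refine (Tendsto.liminf_eq ?_).symm
          exact tendsto_const_nhds.congr' (hx.mono fun m hm => by simp only [hm])
      _ ≤ liminf (fun m => ∫⁻ x in U, ENNReal.ofReal (Φ m x)) atTop :=
          lintegral_liminf_le' fun m => (hΦi m).1.aemeasurable.ennreal_ofReal
      _ ≤ ENNReal.ofReal (∫ x in U, K (f x)) := by
          refine liminf_le_of_le (by isBoundedDefault) fun b hb => ?_
          obtain ⟨m, hm⟩ := hb.exists
          refine hm.trans ?_
          rw [← ofReal_integral_eq_lintegral_ofReal (hΦi m) (ae_of_all _ (hΦ0 m))]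
          exact ENNReal.ofReal_le_ofReal (hΦle m)
  have hΦ'i : Integrable Φ' (volume.restrict U) := by
    refine ⟨hΦ'm, ?_⟩
    rw [hasFiniteIntegral_iff_ofReal hΦ'0]
    exact hlin.trans_lt ENNReal.ofReal_lt_top
  have hle : ∫ x in U, Φ' x ≤ ∫ x in U, K (f x) := by
    rw [← ofReal_integral_eq_lintegral_ofReal hΦ'i hΦ'0] at hlin
    exact (ENNReal.ofReal_le_ofReal_iff hKf0).1 hlin
  have i1 : Integrable (fun x => K (u x)) (volume.restrict U) := by
    refine hΦ'i.mono' hKum ?_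
    filter_upwards [hupos] with x hx
    rw [Real.norm_eq_abs, abs_of_nonneg (hK0 _ hx)]
    exact le_add_of_nonneg_right
      (mul_nonneg ha.le (mul_nonneg (hθ0 _ hx) (weakGradSq_nonneg _ _ _ _)))
  have i2 : Integrable (fun x => θ (u x) * weakGradSq U 1 u x) (volume.restrict U) := by
    refine ((hΦ'i.sub i1).const_mul a⁻¹).congr (ae_of_all _ fun x => ?_)
    simp only [Φ', Pi.sub_apply, add_sub_cancel_left]
    rw [inv_mul_cancel_left₀ ha.ne']
  refine ⟨i1, i2, ?_⟩
  rw [← integral_const_mul, ← integral_add i1 (i2.const_mul a)]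
  exact hle

end ConvexEstimate
end FSI

namespace FSI
open Filter Topology

/-! ### The regularised potential -/

section Potential

variable {n : ℕ} {p : ℝ → ℝ} {γ δ β c : ℝ}

theorem IsPressureLaw.hasDerivAt (hp : IsPressureLaw n p γ) {s : ℝ} (hs : 0 < s) :
    HasDerivAt p (deriv p s) s :=
  ((hp.contDiff_two.differentiableOn (by norm_num)).differentiableAt
    (isOpen_Ioi.mem_nhds hs)).hasDerivAt

theorem IsPressureLaw.hasDerivAt_regPressure (hp : IsPressureLaw n p γ) {s : ℝ} (hs : 0 < s) :
    HasDerivAt (regPressure p δ β) (deriv p s + δ * (β * s ^ (β - 1)) + δ * (2 * s)) s := by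
  have h1 := (Real.hasDerivAt_rpow_const (p := β) (Or.inl hs.ne')).const_mul δ
  have h2 : HasDerivAt (fun s : ℝ => δ * s ^ 2) (δ * (2 * s)) s := by
    simpa using (hasDerivAt_pow 2 s).const_mul δ
  exact ((hp.hasDerivAt hs).add h1).add h2

theorem IsPressureLaw.continuousOn_integrand (hp : IsPressureLaw n p γ) :
    ContinuousOn (fun z => regPressure p δ β z / z ^ 2) (Ioi 0) := fun _ hs =>
  ((hp.hasDerivAt_regPressure hs).continuousAt.div (continuous_pow 2).continuousAt
    (pow_ne_zero 2 (ne_of_gt hs))).continuousWithinAt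

/-- In the second derivative the two terms ±p_δ/s² cancel, which leaves p_δ'(s)/s. -/
theorem IsPressureLaw.hasDerivAt_regPotential (hp : IsPressureLaw n p γ)
    (hcint : IntervalIntegrable (fun z => regPressure p δ β z / z ^ 2) volume c 1)
    {s : ℝ} (hs : 0 < s) :
    HasDerivAt (regPotential p δ β c)
      ((∫ z in c..s, regPressure p δ β z / z ^ 2) + regPressure p δ β s / s) s ∧
    HasDerivAt (fun s => (∫ z in c..s, regPressure p δ β z / z ^ 2) + regPressure p δ β s / s)
      (deriv p s / s + δ * β * s ^ (β - 2) + 2 * δ) s := by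
  have hi : IntervalIntegrable (fun z => regPressure p δ β z / z ^ 2) volume c s := by
    -- Splitting at 1 isolates the possible singularity at c = 0; between 1 and s the integrand is
    -- continuous.
    refine hcint.trans (ContinuousOn.intervalIntegrable ?_)
    refine hp.continuousOn_integrand.mono fun z hz => ?_
    exact lt_of_lt_of_le (lt_min one_pos hs) hz.1
  have hI : HasDerivAt (fun s => ∫ z in c..s, regPressure p δ β z / z ^ 2)
      (regPressure p δ β s / s ^ 2) s :=
    intervalIntegral.integral_hasDerivAt_right hi
      (hp.continuousOn_integrand.stronglyMeasurableAtFilter isOpen_Ioi s hs)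
      (hp.continuousOn_integrand.continuousAt (isOpen_Ioi.mem_nhds hs))
  constructor
  · refine ((hasDerivAt_id s).mul hI).congr_deriv ?_
    simp only [id]
    field_simp
  · refine (hI.add ((hp.hasDerivAt_regPressure hs).div (hasDerivAt_id s) hs.ne')).congr_deriv ?_
    have e1 : s ^ (β - 1) = s ^ (β - 2) * s := by
      rw [← Real.rpow_add_one hs.ne']; congr 1; ring
    simp only [id, e1]
    field_simp
    ring

theorem IsPressureLaw.deriv_deriv_regPotential (hp : IsPressureLaw n p γ)
    (hcint : IntervalIntegrable (fun z => regPressure p δ β z / z ^ 2) volume c 1)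
    {s : ℝ} (hs : 0 < s) :
    deriv (deriv (regPotential p δ β c)) s = deriv p s / s + δ * β * s ^ (β - 2) + 2 * δ := by
  have : deriv (regPotential p δ β c) =ᶠ[𝓝 s]
      fun s => (∫ z in c..s, regPressure p δ β z / z ^ 2) + regPressure p δ β s / s := by
    filter_upwards [isOpen_Ioi.mem_nhds hs] with t ht
    exact (hp.hasDerivAt_regPotential hcint ht).1.deriv
  rw [this.deriv_eq]
  exact (hp.hasDerivAt_regPotential hcint hs).2.deriv

/-- For bounded s, p' is bounded because p is C¹ up to 0, which gives 1/s. For large s, p' grows at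
most like s^(γ−1) with γ < β, which gives s^(β−2). -/
theorem IsPressureLaw.exists_second_deriv_bound (hp : IsPressureLaw n p γ) (hδ : 0 < δ)
    (hβ : max 4 γ < β) :
    ∃ C, 0 ≤ C ∧ ∀ s, 0 < s →
      deriv p s / s + δ * β * s ^ (β - 2) + 2 * δ ≤ C * (1 / s + s ^ (β - 2)) := by
  have hβ4 : 4 < β := (le_max_left _ _).trans_lt hβ
  have hβγ : γ < β := (le_max_right _ _).trans_lt hβ
  obtain ⟨a, ha, hlim⟩ := hp.growth
  obtain ⟨S, hS1, hS⟩ : ∃ S, 1 ≤ S ∧ ∀ s, S ≤ s → deriv p s / s ^ (γ - 1) < a + 1 := by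
    obtain ⟨S, hS⟩ := (eventually_atTop.1 (hlim.eventually (gt_mem_nhds (lt_add_one a))))
    exact ⟨max S 1, le_max_right _ _, fun s hs => hS s ((le_max_left _ _).trans hs)⟩
  obtain ⟨B, hB⟩ := isCompact_Icc.exists_bound_of_continuousOn
    ((hp.contDiff_one.continuousOn_derivWithin (uniqueDiffOn_Ici 0) (by norm_num)).mono
      (Icc_subset_Ici_self : Icc 0 S ⊆ Ici 0))
  have hB0 : 0 ≤ B := (norm_nonneg _).trans (hB 0 ⟨le_rfl, by linarith⟩)
  have key : ∀ s, 0 < s → deriv p s / s ≤ (B + (a + 1)) * (1 / s + s ^ (β - 2)) := by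
    intro s hs
    have h1 : 0 < 1 / s := by positivity
    have h2 : 0 < s ^ (β - 2) := Real.rpow_pos_of_pos hs _
    rcases le_total s S with h | h
    · have h3 := hB s ⟨hs.le, h⟩
      rw [derivWithin_of_mem_nhds (Ici_mem_nhds hs), Real.norm_eq_abs] at h3
      have h4 : deriv p s / s ≤ B * (1 / s) := by
        rw [div_eq_mul_one_div]
        exact mul_le_mul_of_nonneg_right ((le_abs_self _).trans h3) h1.le
      nlinarith [mul_nonneg hB0 h2.le, mul_pos (by linarith : 0 < a + 1) h1,
        mul_pos (by linarith : 0 < a + 1) h2]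
    · have h3 := hS s h
      rw [div_lt_iff₀ (Real.rpow_pos_of_pos hs _)] at h3
      have h4 : deriv p s / s ≤ (a + 1) * s ^ (β - 2) := by
        rw [div_le_iff₀ hs, mul_assoc, ← Real.rpow_add_one hs.ne']
        refine h3.le.trans (mul_le_mul_of_nonneg_left ?_ (by linarith))
        exact Real.rpow_le_rpow_of_exponent_le (hS1.trans h) (by linarith)
      nlinarith [mul_nonneg hB0 h2.le, mul_pos (by linarith : 0 < a + 1) h1,
        mul_nonneg hB0 h1.le]
  refine ⟨(B + (a + 1)) + δ * β + 2 * δ, by positivity, fun s hs => ?_⟩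
  have h1 : 0 < 1 / s := by positivity
  have h2 : 0 < s ^ (β - 2) := Real.rpow_pos_of_pos hs _
  have h3 : 1 ≤ 1 / s + s ^ (β - 2) := by
    rcases le_total s 1 with h | h
    · have : 1 ≤ 1 / s := (one_le_div hs).2 h
      linarith
    · have := Real.one_le_rpow h (by linarith : 0 ≤ β - 2)
      linarith
  have h4 : δ * β * s ^ (β - 2) ≤ δ * β * (1 / s + s ^ (β - 2)) :=
    mul_le_mul_of_nonneg_left (by linarith) (by nlinarith)
  have h5 : 2 * δ ≤ 2 * δ * (1 / s + s ^ (β - 2)) := by nlinarith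
  have := key s hs
  linarith

/-- The convex function with second derivative `s ^ (β - 2)` and double zero at `1`. -/
noncomputable def powerPotential (β s : ℝ) : ℝ := (s ^ β - 1) / (β * (β - 1)) - (s - 1) / (β - 1)

theorem hasDerivAt_powerPotential (hβ : 1 < β) {s : ℝ} (hs : 0 < s) :
    HasDerivAt (powerPotential β) ((s ^ (β - 1) - 1) / (β - 1)) s ∧
    HasDerivAt (fun s : ℝ => (s ^ (β - 1) - 1) / (β - 1)) (s ^ (β - 2)) s := by
  have hb : β ≠ 0 := by linarith
  have hb1 : β - 1 ≠ 0 := by linarith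
  constructor
  · have h1 := ((Real.hasDerivAt_rpow_const (p := β) (Or.inl hs.ne')).sub_const 1).div_const
      (β * (β - 1))
    have h2 := ((hasDerivAt_id s).sub_const 1).div_const (β - 1)
    refine (h1.sub h2).congr_deriv ?_
    field_simp
  · have h1 := ((Real.hasDerivAt_rpow_const (p := β - 1) (Or.inl hs.ne')).sub_const 1).div_const
      (β - 1)
    refine h1.congr_deriv ?_
    rw [mul_div_cancel_left₀ _ hb1]
    congr 1
    ring

theorem rpow_eq_powerPotential (hβ : 1 < β) (s : ℝ) :
    s ^ β = β * (β - 1) * powerPotential β s + (1 + β * (s - 1)) := by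
  have hb : β ≠ 0 := by linarith
  have hb1 : β - 1 ≠ 0 := by linarith
  rw [powerPotential]
  field_simp
  ring

/-- The potential is a positive multiple of s^β plus an affine function, and affine functions of f
are integrable on a finite measure space. -/
theorem integrable_powerPotential_iff {α : Type*} [MeasurableSpace α] {μ : Measure α}
    [IsFiniteMeasure μ] (hβ : 1 < β) {f : α → ℝ} (hf : Integrable f μ)
    (hpos : ∀ᵐ x ∂μ, 0 < f x) :
    Integrable (fun x => powerPotential β (f x)) μ ↔ MemLp f (ENNReal.ofReal β) μ := by
  have hb : (ENNReal.ofReal β).toReal = β := ENNReal.toReal_ofReal (by linarith)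
  have hb0 : ENNReal.ofReal β ≠ 0 := by simpa using by linarith
  have hlin : Integrable (fun x => 1 + β * (f x - 1)) μ :=
    (integrable_const 1).add ((hf.sub (integrable_const 1)).const_mul β)
  rw [← integrable_norm_rpow_iff hf.1 hb0 ENNReal.ofReal_ne_top, hb]
  have hab : (fun x => ‖f x‖ ^ β) =ᵐ[μ] fun x => f x ^ β := by
    filter_upwards [hpos] with x hx
    rw [Real.norm_eq_abs, abs_of_pos hx]
  rw [integrable_congr hab]
  constructor
  · intro h
    refine ((h.const_mul (β * (β - 1))).add hlin).congr (ae_of_all _ fun x => ?_)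
    exact (rpow_eq_powerPotential hβ (f x)).symm
  · intro h
    refine ((h.sub hlin).const_mul (β * (β - 1))⁻¹).congr (ae_of_all _ fun x => ?_)
    have hne : β * (β - 1) ≠ 0 := mul_ne_zero (by linarith) (by linarith)
    simp only [Pi.sub_apply, rpow_eq_powerPotential hβ (f x), add_sub_cancel_right]
    rw [inv_mul_cancel_left₀ hne]

/-- The functions s log s − s + 1 and `powerPotential` have second derivatives 1/s and s^(β−2) and
double zeros at 1, so comparison applies; log s ≤ s − 1 then removes the logarithm. -/
theorem convex_growth_bound {K K' θ : ℝ → ℝ} (hK : ∀ s, 0 < s → HasDerivAt K (K' s) s)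
    (hK' : ∀ s, 0 < s → HasDerivAt K' (θ s) s) (h0 : K 1 = 0) (h1 : K' 1 = 0) (hβ : 1 < β)
    {C : ℝ} (hC : 0 ≤ C) (hθ : ∀ s, 0 < s → θ s ≤ C * (1 / s + s ^ (β - 2))) {s : ℝ}
    (hs : 0 < s) : K s ≤ C * ((s - 1) ^ 2 + powerPotential β s) := by
  have hJ : ∀ s : ℝ, 0 < s → HasDerivAt (fun s => s * Real.log s - s + 1) (Real.log s) s := by
    intro s hs
    refine ((((hasDerivAt_id s).mul (Real.hasDerivAt_log hs.ne')).sub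
      (hasDerivAt_id s)).add_const 1).congr_deriv ?_
    simp [hs.ne']
  have key := nonneg_of_hasDerivAt_two_nonneg (S := Ioi 0) ordConnected_Ioi
    (F := fun s => C * ((s * Real.log s - s + 1) + powerPotential β s) - K s)
    (fun s h => (((hJ s h).add (hasDerivAt_powerPotential hβ h).1).const_mul C).sub (hK s h))
    (fun s h => (((Real.hasDerivAt_log (ne_of_gt h)).add
      (hasDerivAt_powerPotential hβ h).2).const_mul C).sub (hK' s h))
    (fun s h => by
      have := hθ s h
      rw [one_div] at this
      linarith)
    (a := 1) (mem_Ioi.2 one_pos) (by simp [powerPotential, h0]) (by simp [h1]) hs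
  have hlog : s * Real.log s ≤ s * (s - 1) :=
    mul_le_mul_of_nonneg_left (Real.log_le_sub_one_of_pos hs) hs.le
  have : C * ((s * Real.log s - s + 1) + powerPotential β s) ≤
      C * ((s - 1) ^ 2 + powerPotential β s) :=
    mul_le_mul_of_nonneg_left (by nlinarith) hC
  linarith

end Potential

/-! ### Integrability and energy decay of the regularised density -/

section NeumannEnergy

variable {n : ℕ} {p : ℝ → ℝ} {γ δ β c : ℝ} {U : Set (Vec n)} {a : ℝ} {f u : Vec n → ℝ}

/-- This makes ρ̃_k an admissible competitor density. It is the convex estimate for the power s^β.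
-/
theorem IsNeumannResolvent.memLp (hU : IsOpen U) (hUb : Bornology.IsBounded U) (ha : 0 < a)
    (h : IsNeumannResolvent U a f u) (hβ : 1 < β)
    (hf : MemLp f (ENNReal.ofReal β) (volume.restrict U))
    (hfpos : ∀ᵐ x ∂volume.restrict U, 0 < f x) :
    MemLp u (ENNReal.ofReal β) (volume.restrict U) := by
  have : IsFiniteMeasure (volume.restrict U) := ⟨by simpa using hUb.measure_lt_top⟩
  have hfi : Integrable f (volume.restrict U) :=
    hf.integrable (by rw [← ENNReal.ofReal_one]; exact ENNReal.ofReal_le_ofReal hβ.le)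
  have hui : Integrable u (volume.restrict U) := h.1.1.integrable (by norm_num)
  rw [← integrable_powerPotential_iff hβ hui (h.ae_pos hU hUb ha.le hfi hfpos)]
  refine (h.convex_estimate hU hUb ha hfi hfpos
    (fun _ hs => (hasDerivAt_powerPotential hβ hs).1)
    (fun _ hs => (hasDerivAt_powerPotential hβ hs).2) (fun s hs => ?_)
    (fun _ hs => (Real.rpow_pos_of_pos hs _).le) (by simp [powerPotential]) (by simp)
    ((integrable_powerPotential_iff hβ hfi hfpos).2 hf)).1
  exact (Real.continuousAt_rpow_const _ _ (Or.inl (ne_of_gt hs))).continuousWithinAt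

theorem IsNeumannResolvent.potential_estimate (hU : IsOpen U) (hUb : Bornology.IsBounded U)
    (ha : 0 < a) (h : IsNeumannResolvent U a f u) (hp : IsPressureLaw n p γ) (hδ : 0 < δ)
    (hβ : max 4 γ < β)
    (hcint : IntervalIntegrable (fun z => regPressure p δ β z / z ^ 2) volume c 1)
    (hf : MemLp f (ENNReal.ofReal β) (volume.restrict U))
    (hfpos : ∀ᵐ x ∂volume.restrict U, 0 < f x) :
    IntegrableOn (fun x => deriv (deriv (regPotential p δ β c)) (u x) * weakGradSq U 1 u x) U ∧
    (∫ x in U, regPotential p δ β c (u x)) +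
      a * (∫ x in U, deriv (deriv (regPotential p δ β c)) (u x) * weakGradSq U 1 u x) ≤
      ∫ x in U, regPotential p δ β c (f x) := by
  have : IsFiniteMeasure (volume.restrict U) := ⟨by simpa using hUb.measure_lt_top⟩
  have hβ4 : 4 < β := (le_max_left _ _).trans_lt hβ
  have hβ1 : 1 < β := by linarith
  have hfi : Integrable f (volume.restrict U) :=
    hf.integrable (by rw [← ENNReal.ofReal_one]; exact ENNReal.ofReal_le_ofReal hβ1.le)
  have hf2 : MemLp f 2 (volume.restrict U) := hf.mono_exponent (by
    rw [← ENNReal.ofReal_ofNat]; exact ENNReal.ofReal_le_ofReal (by linarith))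
  have hui : Integrable u (volume.restrict U) := h.1.1.integrable (by norm_num)
  have hupos := h.ae_pos hU hUb ha.le hfi hfpos
  set H := regPotential p δ β c with hH
  let H' : ℝ → ℝ := fun s => (∫ z in c..s, regPressure p δ β z / z ^ 2) + regPressure p δ β s / s
  let θ : ℝ → ℝ := fun s => deriv p s / s + δ * β * s ^ (β - 2) + 2 * δ
  -- Subtracting the tangent at 1 produces the required double zero. The affine part has the same
  -- integral for u and f by conservation of mass, so it drops out at the end.
  let K : ℝ → ℝ := fun s => H s - (H 1 + H' 1 * (s - 1))
  have hK : ∀ s, 0 < s → HasDerivAt K (H' s - H' 1) s := fun s hs => by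
    have h1 : HasDerivAt (fun s : ℝ => H 1 + H' 1 * (s - 1)) (H' 1) s := by
      simpa using (((hasDerivAt_id s).sub_const 1).const_mul (H' 1)).const_add (H 1)
    exact (hp.hasDerivAt_regPotential hcint hs).1.sub h1
  have hK' : ∀ s, 0 < s → HasDerivAt (fun s => H' s - H' 1) (θ s) s := fun s hs =>
    (hp.hasDerivAt_regPotential hcint hs).2.sub_const _
  have hθc : ContinuousOn θ (Ioi 0) := by
    have h1 : ContinuousOn (deriv p) (Ioi 0) :=
      hp.contDiff_two.continuousOn_deriv_of_isOpen isOpen_Ioi (by norm_num)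
    have h2 : ContinuousOn (fun s : ℝ => s ^ (β - 2)) (Ioi 0) := fun s hs =>
      (Real.continuousAt_rpow_const _ _ (Or.inl (ne_of_gt hs))).continuousWithinAt
    exact ((h1.div continuousOn_id fun s hs => ne_of_gt hs).add
      (continuousOn_const.mul h2)).add continuousOn_const
  have hθ0 : ∀ s, 0 < s → 0 ≤ θ s := fun s hs => by
    have h1 := hp.deriv_pos s hs
    have h2 := Real.rpow_pos_of_pos hs (β - 2)
    have h3 : 0 < β := by linarith
    positivity
  have hK1 : K 1 = 0 := by simp [K]
  obtain ⟨C, hC0, hC⟩ := hp.exists_second_deriv_bound hδ hβ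
  have hKf : Integrable (fun x => K (f x)) (volume.restrict U) := by
    have hdom : Integrable (fun x => C * ((f x - 1) ^ 2 + powerPotential β (f x)))
        (volume.restrict U) :=
      ((hf2.sub (memLp_const 1)).integrable_sq.add
        ((integrable_powerPotential_iff hβ1 hfi hfpos).2 hf)).const_mul C
    refine hdom.mono' (aestronglyMeasurable_comp_of_continuousOn_Ioi hf.1 hfpos
      fun s hs => (hK s hs).continuousAt.continuousWithinAt) ?_
    filter_upwards [hfpos] with x hx
    have h0 : 0 ≤ K (f x) :=
      nonneg_of_hasDerivAt_two_nonneg (S := Ioi 0) ordConnected_Ioi hK hK' hθ0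
        (mem_Ioi.2 one_pos) hK1 (sub_self _) hx
    rw [Real.norm_eq_abs, abs_of_nonneg h0]
    exact convex_growth_bound hK hK' hK1 (sub_self _) hβ1 hC0 hC hx
  obtain ⟨i1, i2, hle⟩ := h.convex_estimate hU hUb ha hfi hfpos hK hK' hθc hθ0 hK1
    (sub_self _) hKf
  have hcongr : (fun x => θ (u x) * weakGradSq U 1 u x) =ᵐ[volume.restrict U]
      fun x => deriv (deriv H) (u x) * weakGradSq U 1 u x := by
    filter_upwards [hupos] with x hx
    rw [hH, hp.deriv_deriv_regPotential hcint hx]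
  have hsplit : ∀ v : Vec n → ℝ, Integrable v (volume.restrict U) →
      Integrable (fun x => K (v x)) (volume.restrict U) →
      ∫ x in U, H (v x) = (∫ x in U, K (v x)) + ((∫ _ in U, (H 1 - H' 1)) +
        H' 1 * ∫ x in U, v x) := fun v hv hKv => by
    have hl : Integrable (fun x => H' 1 * v x) (volume.restrict U) := hv.const_mul _
    have hl' : Integrable (fun x => (H 1 - H' 1) + H' 1 * v x) (volume.restrict U) :=
      (integrable_const _).add hl
    rw [← integral_const_mul, ← integral_add (integrable_const _) hl, ← integral_add hKv hl']
    exact integral_congr_ae (ae_of_all _ fun x => by simp only [K]; ring)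
  refine ⟨i2.congr hcongr, ?_⟩
  rw [← integral_congr_ae hcongr, hsplit u hui i1, hsplit f hfi hKf, h.integral_eq hU hUb]
  linarith

end NeumannEnergy
end FSI

namespace FSI
open Filter Topology

/-! ### Diffeomorphisms with positive Jacobian -/

section Flow

variable {n : ℕ}

/-- `Φ` is a `C¹` bijection of `A` onto `B` with positive Jacobian determinant. -/
structure IsPosDiffeoOn (Φ : Vec n → Vec n) (A B : Set (Vec n)) : Prop where
  bijOn : BijOn Φ A B
  contDiffOn : ContDiffOn ℝ 1 Φ A
  det_pos : ∀ x ∈ A, 0 < (fderiv ℝ Φ x).det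

theorem IsPosDiffeoOn.id (A : Set (Vec n)) : IsPosDiffeoOn (_root_.id : Vec n → Vec n) A A := by
  refine ⟨bijOn_id A, contDiffOn_id, fun x _ => ?_⟩
  rw [fderiv_id, ContinuousLinearMap.det]
  simp

theorem IsPosDiffeoOn.differentiableAt {Φ : Vec n → Vec n} {A B : Set (Vec n)} (hA : IsOpen A)
    (h : IsPosDiffeoOn Φ A B) {x : Vec n} (hx : x ∈ A) : DifferentiableAt ℝ Φ x :=
  (h.contDiffOn.differentiableOn (by norm_num)).differentiableAt (hA.mem_nhds hx)

theorem IsPosDiffeoOn.comp {Φ Ψ : Vec n → Vec n} {A B C : Set (Vec n)} (hA : IsOpen A)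
    (hB : IsOpen B) (hΨ : IsPosDiffeoOn Ψ B C) (hΦ : IsPosDiffeoOn Φ A B) :
    IsPosDiffeoOn (Ψ ∘ Φ) A C := by
  refine ⟨hΨ.bijOn.comp hΦ.bijOn, hΨ.contDiffOn.comp hΦ.contDiffOn hΦ.bijOn.mapsTo,
    fun x hx => ?_⟩
  have hx' := hΦ.bijOn.mapsTo hx
  rw [fderiv_comp x (hΨ.differentiableAt hB hx') (hΦ.differentiableAt hA hx)]
  have : ((fderiv ℝ Ψ (Φ x)).comp (fderiv ℝ Φ x)).det =
      (fderiv ℝ Ψ (Φ x)).det * (fderiv ℝ Φ x).det := by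
    simp only [ContinuousLinearMap.det, ContinuousLinearMap.toLinearMap_comp, LinearMap.det_comp]
  rw [this]
  exact mul_pos (hΨ.det_pos _ hx') (hΦ.det_pos _ hx)

/-- By injectivity on A, the global inverse coincides near Φ y with the local inverse of the inverse
function theorem, whose derivative is known. -/
theorem IsPosDiffeoOn.det_fderiv_invFunOn {Φ : Vec n → Vec n} {A B : Set (Vec n)} (hA : IsOpen A)
    (h : IsPosDiffeoOn Φ A B) {y : Vec n} (hy : y ∈ A) :
    (fderiv ℝ (Function.invFunOn Φ A) (Φ y)).det = ((fderiv ℝ Φ y).det)⁻¹ := by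
  have hdet : (fderiv ℝ Φ y).det ≠ 0 := (h.det_pos y hy).ne'
  set e := (fderiv ℝ Φ y).toContinuousLinearEquivOfDetNeZero hdet
  have he : (e : Vec n →L[ℝ] Vec n) = fderiv ℝ Φ y :=
    ContinuousLinearMap.coe_toContinuousLinearEquivOfDetNeZero _ hdet
  have hs : HasStrictFDerivAt Φ (e : Vec n →L[ℝ] Vec n) y := by
    rw [he]
    exact (h.contDiffOn.contDiffAt (hA.mem_nhds hy)).hasStrictFDerivAt (by norm_num)
  have hloc := hs.to_localInverse.hasFDerivAt
  have hmem : ∀ᶠ z in 𝓝 (Φ y), hs.localInverse Φ e y z ∈ A := by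
    have hc := hs.localInverse_continuousAt
    exact hc.eventually_mem (by rw [hs.localInverse_apply_image]; exact hA.mem_nhds hy)
  have heq : Function.invFunOn Φ A =ᶠ[𝓝 (Φ y)] hs.localInverse Φ e y := by
    filter_upwards [hmem, hs.eventually_right_inverse] with z hz hz'
    have := h.bijOn.injOn.leftInvOn_invFunOn hz
    rwa [hz'] at this
  rw [(hloc.congr_of_eventuallyEq heq).fderiv, ContinuousLinearEquiv.det_coe_symm, he]

/-- The squared weight det ∇Φ⁻¹ is exactly cancelled by the Jacobian of the change of variables. -/
theorem IsPosDiffeoOn.integral_transported {Φ : Vec n → Vec n} {A B : Set (Vec n)}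
    (hA : IsOpen A) (h : IsPosDiffeoOn Φ A B) (w : Vec n → Vec n) :
    ∫ x in B, ‖Data.transported A Φ w x‖ ^ 2 = ∫ x in A, ‖w x‖ ^ 2 := by
  rw [← h.bijOn.image_eq, integral_image_eq_integral_abs_det_fderiv_smul volume hA.measurableSet
    (fun x hx => (h.differentiableAt hA hx).hasFDerivAt.hasFDerivWithinAt) h.bijOn.injOn]
  refine setIntegral_congr_fun hA.measurableSet fun y hy => ?_
  have hd := h.det_pos y hy
  simp only [Data.transported]
  rw [h.det_fderiv_invFunOn hA hy, h.bijOn.injOn.leftInvOn_invFunOn hy, norm_smul, mul_pow,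
    Real.norm_eq_abs, sq_abs, Real.sq_sqrt (inv_pos.2 hd).le, abs_of_pos hd, smul_eq_mul,
    mul_inv_cancel_left₀ hd.ne']

/-- The exceptional set in B is contained in the image of a null set, and differentiable maps send
null sets to null sets. -/
theorem IsPosDiffeoOn.ae_of_ae_comp {Φ : Vec n → Vec n} {A B : Set (Vec n)} (hA : IsOpen A)
    (hB : IsOpen B) (h : IsPosDiffeoOn Φ A B) {P : Vec n → Prop}
    (hP : ∀ᵐ x ∂volume.restrict A, P (Φ x)) : ∀ᵐ y ∂volume.restrict B, P y := by
  rw [ae_restrict_iff' hA.measurableSet, ae_iff] at hP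
  rw [ae_restrict_iff' hB.measurableSet, ae_iff]
  have hnull := addHaar_image_eq_zero_of_differentiableOn_of_addHaar_eq_zero volume (f := Φ)
    (s := {x | ¬(x ∈ A → P (Φ x))}) (fun x hx => by
      simp only [mem_ofPred_eq, Classical.not_imp] at hx
      exact (h.differentiableAt hA hx.1).differentiableWithinAt) hP
  refine measure_mono_null (fun y hy => ?_) hnull
  simp only [mem_ofPred_eq, Classical.not_imp] at hy
  obtain ⟨x, hx, rfl⟩ := h.bijOn.surjOn hy.1
  exact ⟨x, by simpa using ⟨hx, hy.2⟩, rfl⟩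

end Flow

/-! ### One step of the scheme -/

namespace Data

variable {n : ℕ} {D : Data n}

theorem MemE.isOpen_fluid (hΩ : IsOpen D.Ω) (hQb : Bornology.IsBounded D.Q) {η : Vec n → Vec n}
    (hη : D.MemE η) : IsOpen (D.fluid η) := by
  have hc : IsCompact (η '' closure D.Q) :=
    hQb.isCompact_closure.image_of_continuousOn hη.continuousOn
  exact hΩ.sdiff hc.isClosed

theorem isBounded_fluid (hΩb : Bornology.IsBounded D.Ω) (η : Vec n → Vec n) :
    Bornology.IsBounded (D.fluid η) := hΩb.subset sdiff_subset

theorem Ψ_zero : D.Ψ 0 = id := by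
  funext x
  simp [Ψ]

theorem dq_self (η : Vec n → Vec n) : D.dq η η = 0 := by
  funext x
  simp [dq]

theorem viscous_zero (η : Vec n → Vec n) : D.viscous η 0 = 0 := by
  have : ∀ x, velGrad (0 : Vec n → Vec n) x = 0 := fun x => by
    ext i j
    simp [velGrad]
  simp [viscous, this, frobDot]

theorem IsAdmissible.isPosDiffeoOn {ηk η v : Vec n → Vec n} {ρt ρ : Vec n → ℝ}
    (h : D.IsAdmissible ηk ρt η v ρ) : IsPosDiffeoOn (D.Ψ v) (D.fluid ηk) (D.fluid η) :=
  ⟨h.bijOn, contDiffOn_id.add (h.v_contDiffOn.const_smul D.τ), h.det_pos⟩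

theorem isAdmissible_self {η : Vec n → Vec n} {ρt : Vec n → ℝ} (hη : D.MemE η)
    (hη' : MemSobolev D.Q D.k₀ 2 η)
    (hρt : MemLp ρt (ENNReal.ofReal D.β) (volume.restrict (D.fluid η))) :
    D.IsAdmissible η ρt η 0 ρt := by
  have hid := IsPosDiffeoOn.id (D.fluid η)
  refine ⟨hη, hη', memSobolev_zero _ _ _, contDiffOn_const, continuousOn_const, fun _ _ => rfl,
    fun y _ => by rw [dq_self]; rfl, ?_, ?_, hρt, ae_of_all _ fun x => ?_⟩
  · rw [Ψ_zero]; exact hid.bijOn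
  · rw [Ψ_zero]; exact hid.det_pos
  · rw [Ψ_zero, fderiv_id, ContinuousLinearMap.det]
    simp

theorem functional_self (hQ : IsOpen D.Q)
    (hR : ∀ η b : Vec n → Vec n, D.MemE η → MemSobolev D.Q 1 2 b →
      ∀ l : ℝ, D.R η (l • b) = l ^ 2 * D.R η b)
    {Ω₀ : Set (Vec n)} (hΩ₀ : IsOpen Ω₀) {Φ η : Vec n → Vec n} {ρ ρt : Vec n → ℝ} {k : ℕ}
    (hη : D.MemE η) (hfl : IsOpen (D.fluid η)) (hΦ : IsPosDiffeoOn Φ Ω₀ (D.fluid η)) :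
    D.functional k Ω₀ Φ η ρ η 0 ρt = D.Eκ η + D.U η ρt + D.τ / (2 * D.h) *
      (D.ρs * (∫ y in D.Q, ‖D.ζavg k y‖ ^ 2) + ∫ x in Ω₀, ‖D.wavg k x‖ ^ 2) := by
  -- Homogeneity with l = 0 and b = 0.
  have hR0 : D.R η 0 = 0 := by
    simpa using hR η 0 hη (memSobolev_zero _ _ _) 0
  have h1 : D.Rκ η (D.dq η η) = 0 := by
    rw [dq_self, Rκ, hR0, integral_weakGradSq_zero hQ]
    simp
  have h2 : D.forcePower k η ρ η 0 = 0 := by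
    simp [forcePower, dq_self]
  have h3 : D.solidInertia k η η = D.ρs * ∫ y in D.Q, ‖D.ζavg k y‖ ^ 2 := by
    simp [solidInertia, dq_self]
  have h4 : D.fluidInertia k Ω₀ Φ η ρ 0 = ∫ x in Ω₀, ‖D.wavg k x‖ ^ 2 := by
    rw [← hΦ.integral_transported hΩ₀]
    simp [fluidInertia]
  rw [functional, h1, h2, h3, h4, viscous_zero, integral_weakGradSq_zero hfl]
  ring

/-- The properties of `(η_k, ρ_k, Φ_k)` that are preserved by the scheme. -/
structure IsRegularState (D : Data n) (Ω₀ : Set (Vec n)) (Φ η : Vec n → Vec n)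
    (ρ : Vec n → ℝ) : Prop where
  memE : D.MemE η
  sobolev : MemSobolev D.Q D.k₀ 2 η
  diffeo : IsPosDiffeoOn Φ Ω₀ (D.fluid η)
  ρ_memLp : MemLp ρ (ENNReal.ofReal D.β) (volume.restrict (D.fluid η))
  ρ_pos : ∀ᵐ x ∂volume.restrict (D.fluid η), 0 < ρ x

/-- Positivity is the delicate point: ρ' ∘ Ψ_v = ρ̃ / det ∇Ψ_v is positive almost everywhere on the
old domain, and Ψ_v carries this over to the new one. -/
theorem IsRegularState.step (hΩ : IsOpen D.Ω) (hΩb : Bornology.IsBounded D.Ω)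
    (hQb : Bornology.IsBounded D.Q) (hτε : 0 < D.τ * D.ε) (hβ : 1 < D.β)
    {Ω₀ : Set (Vec n)} (hΩ₀ : IsOpen Ω₀) {Φ η η' v : Vec n → Vec n} {ρ ρt ρ' : Vec n → ℝ}
    (h : D.IsRegularState Ω₀ Φ η ρ)
    (hρt : IsNeumannResolvent (D.fluid η) (D.τ * D.ε) ρ ρt)
    (hadm : D.IsAdmissible η ρt η' v ρ') :
    D.IsRegularState Ω₀ (D.Ψ v ∘ Φ) η' ρ' := by
  have hfl := h.memE.isOpen_fluid hΩ hQb
  have hfl' := hadm.memE.isOpen_fluid hΩ hQb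
  have hb := isBounded_fluid hΩb η
  have : IsFiniteMeasure (volume.restrict (D.fluid η)) := ⟨by simpa using hb.measure_lt_top⟩
  have hρi : Integrable ρ (volume.restrict (D.fluid η)) :=
    h.ρ_memLp.integrable (by rw [← ENNReal.ofReal_one]; exact ENNReal.ofReal_le_ofReal hβ.le)
  have hpos := hρt.ae_pos hfl hb hτε.le hρi h.ρ_pos
  refine ⟨hadm.memE, hadm.sobolev, hadm.isPosDiffeoOn.comp hΩ₀ hfl h.diffeo, hadm.ρ_memLp,
    hadm.isPosDiffeoOn.ae_of_ae_comp hfl hfl' ?_⟩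
  filter_upwards [hadm.transport, hpos, ae_restrict_mem hfl.measurableSet] with x hx hx' hxU
  rw [hx]
  exact div_pos hx' (hadm.det_pos x hxU)

theorem IsRegularState.energy_step {γ : ℝ} (hΩ : IsOpen D.Ω) (hΩb : Bornology.IsBounded D.Ω)
    (hQ : IsOpen D.Q) (hQb : Bornology.IsBounded D.Q) (hτ : 0 < D.τ) (hε : 0 < D.ε)
    (hδ : 0 < D.δ)
    (hR : ∀ η b : Vec n → Vec n, D.MemE η → MemSobolev D.Q 1 2 b →
      ∀ l : ℝ, D.R η (l • b) = l ^ 2 * D.R η b)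
    (hp : IsPressureLaw n D.p γ) (hβ : max 4 γ < D.β)
    (hcint : IntervalIntegrable (fun z => regPressure D.p D.δ D.β z / z ^ 2) volume D.c 1)
    {Ω₀ : Set (Vec n)} (hΩ₀ : IsOpen Ω₀) {Φ η η' v : Vec n → Vec n} {ρ ρt ρ' : Vec n → ℝ} {k : ℕ}
    (h : D.IsRegularState Ω₀ Φ η ρ)
    (hρt : IsNeumannResolvent (D.fluid η) (D.τ * D.ε) ρ ρt)
    (hmin : D.IsMinimizer k Ω₀ Φ η ρ ρt η' v ρ') :
    IntegrableOn (fun x => deriv (deriv D.H) (ρt x) * weakGradSq (D.fluid η) 1 ρt x)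
      (D.fluid η) ∧
    D.functional k Ω₀ Φ η ρ η' v ρ' + D.τ * D.ε *
        (∫ x in D.fluid η, deriv (deriv D.H) (ρt x) * weakGradSq (D.fluid η) 1 ρt x) ≤
      D.Eκ η + D.U η ρ + D.τ / (2 * D.h) *
        (D.ρs * (∫ y in D.Q, ‖D.ζavg k y‖ ^ 2) + ∫ x in Ω₀, ‖D.wavg k x‖ ^ 2) := by
  have hfl := h.memE.isOpen_fluid hΩ hQb
  have hb := isBounded_fluid hΩb η
  have hτε : 0 < D.τ * D.ε := mul_pos hτ hε
  have hβ1 : 1 < D.β := by linarith [(le_max_left 4 γ).trans_lt hβ]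
  have hLp := hρt.memLp hfl hb hτε hβ1 h.ρ_memLp h.ρ_pos
  obtain ⟨hi, hle⟩ := hρt.potential_estimate hfl hb hτε hp hδ hβ hcint h.ρ_memLp h.ρ_pos
  refine ⟨hi, ?_⟩
  have hcomp := hmin.2 η 0 ρt (isAdmissible_self h.memE h.sobolev hLp)
  rw [functional_self hQ hR hΩ₀ h.memE hfl h.diffeo] at hcomp
  change D.U η ρt + _ ≤ D.U η ρ at hle
  change _ + D.τ * D.ε * (∫ x in D.fluid η,
    deriv (deriv (regPotential D.p D.δ D.β D.c)) (ρt x) * weakGradSq (D.fluid η) 1 ρt x) ≤ _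
  linarith

end Data
end FSI

/-! ### Summation over the time steps -/

theorem mainTheorem8 {n : ℕ} (hn : 2 ≤ n) (D : FSI.Data n) (γ : ℝ)
    -- the domains
    (hΩ : IsOpen D.Ω) (hΩb : Bornology.IsBounded D.Ω)
    (hQ : IsOpen D.Q) (hQb : Bornology.IsBounded D.Q) (hM : D.M ⊆ frontier D.Q)
    -- the parameters
    (hq : (n : ℝ) < D.q) (hk₀ : (n : ℝ) / 2 + 2 < (D.k₀ : ℝ))
    (hκ : 0 < D.κ) (hτ : 0 < D.τ) (hh : 0 < D.h) (hε : 0 < D.ε) (hδ : 0 < D.δ)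
    (hmu : 0 < D.mu) (hlam : 0 < D.lam) (hρs : 0 < D.ρs)
    -- the elastic energy is bounded below; the dissipation is homogeneous of degree two
    (hE : ∃ Emin : ℝ, ∀ η : FSI.Vec n → FSI.Vec n,
      FSI.MemSobolev D.Q 2 (ENNReal.ofReal D.q) η → (Emin : EReal) ≤ D.E η)
    (hR : ∀ η b : FSI.Vec n → FSI.Vec n, D.MemE η → FSI.MemSobolev D.Q 1 2 b →
      ∀ l : ℝ, D.R η (l • b) = l ^ 2 * D.R η b)
    -- the pressure and the potential
    (hp : FSI.IsPressureLaw n D.p γ) (hβ : max 4 γ < D.β) (hc : 0 ≤ D.c)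
    (hcint : IntervalIntegrable (fun z => FSI.regPressure D.p D.δ D.β z / z ^ 2) volume D.c 1)
    -- the iterates; `ρt k` is `ρ̃_k`
    (η v : ℕ → FSI.Vec n → FSI.Vec n) (ρ ρt : ℕ → FSI.Vec n → ℝ)
    -- the initial data
    (hη₀ : D.MemE (η 0)) (hη₀' : FSI.MemSobolev D.Q D.k₀ 2 (η 0))
    (hρ₀ : MemLp (ρ 0) (ENNReal.ofReal D.β) (volume.restrict (D.fluid (η 0))))
    (hρ₀pos : ∀ᵐ x ∂(volume.restrict (D.fluid (η 0))), 0 < ρ 0 x)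
    -- the remaining data
    (hζ : MemLp (Function.uncurry D.ζ) 2
      ((volume.restrict (Icc 0 D.h)).prod (volume.restrict D.Q)))
    (hw : MemLp (Function.uncurry D.w) 2
      ((volume.restrict (Icc 0 D.h)).prod (volume.restrict (D.fluid (η 0)))))
    (hfs : ContinuousOn D.fs (Icc 0 D.h)) (hff : ContinuousOn D.ff (Icc 0 D.h))
    -- the minimisation scheme
    (N : ℕ) (hN : D.τ * N ≤ D.h)
    (hρt : ∀ k < N, FSI.IsNeumannResolvent (D.fluid (η k)) (D.τ * D.ε) (ρ k) (ρt k))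
    (hmin : ∀ k < N, D.IsMinimizer k (D.fluid (η 0)) (D.Φ v k) (η k) (ρ k) (ρt k)
      (η (k + 1)) (v (k + 1)) (ρ (k + 1))) :
    (∀ k < N, IntegrableOn
      (fun x => deriv (deriv D.H) (ρt k x) * FSI.weakGradSq (D.fluid (η k)) 1 (ρt k) x)
      (D.fluid (η k))) ∧
    D.Eκ (η N) + D.U (η N) (ρ N)
      + ∑ k ∈ Finset.range N, D.τ * (D.κ / 2) *
          (∫ x in D.fluid (η k), FSI.weakGradSq (D.fluid (η k)) D.k₀ (v (k + 1)) x)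
      + ∑ k ∈ Finset.range N, D.τ *
          (D.Rκ (η k) (D.dq (η k) (η (k + 1)))
            + 1 / 2 * D.viscous (η k) (v (k + 1))
            + D.ε * (∫ x in D.fluid (η k),
                deriv (deriv D.H) (ρt k x) * FSI.weakGradSq (D.fluid (η k)) 1 (ρt k) x))
      + ∑ k ∈ Finset.range N, D.τ / (2 * D.h) *
          (D.solidInertia k (η k) (η (k + 1))
            + D.fluidInertia k (D.fluid (η 0)) (D.Φ v k) (η k) (ρ k) (v (k + 1)))
    ≤ D.Eκ (η 0) + D.U (η 0) (ρ 0)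
      + ∑ k ∈ Finset.range N, D.τ / (2 * D.h) *
          (D.ρs * (∫ y in D.Q, ‖D.ζavg k y‖ ^ 2)
            + (∫ x in D.fluid (η 0), ‖D.wavg k x‖ ^ 2))
      + ∑ k ∈ Finset.range N, D.τ *
          D.forcePower k (η k) (ρ k) (η (k + 1)) (v (k + 1)) := by
  have hβ1 : 1 < D.β := by linarith [(le_max_left 4 γ).trans_lt hβ]
  have hΩ₀ : IsOpen (D.fluid (η 0)) := hη₀.isOpen_fluid hΩ hQb
  have hstate : ∀ k ≤ N, D.IsRegularState (D.fluid (η 0)) (D.Φ v k) (η k) (ρ k) := by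
    intro k
    induction k with
    | zero => exact fun _ => ⟨hη₀, hη₀', FSI.IsPosDiffeoOn.id _, hρ₀, hρ₀pos⟩
    | succ k ih =>
      intro hk
      exact (ih (by omega)).step hΩ hΩb hQb (mul_pos hτ hε) hβ1 hΩ₀ (hρt k hk) (hmin k hk).1
  have hstep := fun k (hk : k < N) =>
    (hstate k hk.le).energy_step hΩ hΩb hQ hQb hτ hε hδ hR hp hβ hcint hΩ₀ (hρt k hk) (hmin k hk)
  refine ⟨fun k hk => (hstep k hk).1, ?_⟩
  -- The left side of step k contains E_κ + U at k + 1 and the right side at k, so the sum retains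
  -- only the indices N and 0.
  have htel := Finset.sum_range_sub (fun k => D.Eκ (η k) + D.U (η k) (ρ k)) N
  have hsum := Finset.sum_le_sum fun k hk => (hstep k (Finset.mem_range.1 hk)).2
  simp only [FSI.Data.functional] at hsum
  rw [← sub_nonneg, ← Finset.sum_sub_distrib] at hsum
  rw [← sub_nonneg, show ∀ E₀ E₁ a b c d e : ℝ, E₀ + d + e - (E₁ + a + b + c) =
    d + e - a - b - c - (E₁ - E₀) from fun _ _ _ _ _ _ _ => by ring, ← htel]
  simp only [← Finset.sum_add_distrib, ← Finset.sum_sub_distrib]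
  refine hsum.trans_eq (Finset.sum_congr rfl fun k _ => ?_)
  ring
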